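/- For a finite nonnegative Borel measure $H$ on $\mathbb R$, let $Y_H$ denote any random variable with $$\mathsf E e^{ikY_H}=\exp\Big\{-k^2\int_{\mathbb R}H(du)\,(R_1\exp)(0;iku)\Big\}\qquad\text{for all }k\in\mathbb R,$$ where $(R_1\exp)(0;z):=(e^z-1-z)/z^2$ for $z\ne0$ and $(R_1\exp)(0;0):=\tfrac12$. Take any $q\in(2,\infty)$, $t_0\in(0,\infty)$ and $\sigma\in(0,\infty)$. Let $H$ be a nonnegative Borel measure on $\mathbb R$ and let $\Delta$ be a real-valued (signed) Borel measure on $\mathbb R$ such that the measure $H_t:=H+t\Delta$ is nonnegative for all $t\in[0,t_0]$. Let $Y$ be a random variable that is independent of $Y_{H_t}$ for each $t\in[0,t_0)$, and suppose that $$\int_{\mathbb R}\big(\mathsf P(Y\in du)+H(du)+|\Delta|(du)\big)\,e^{\sigma|u|}<\infty .$$ Let $(\partial/\partial t)^+$ denote the right-hand derivative in $t$, and let $(\partial^2/\partial t^2)^+:=(\partial/\partial t)^+(\partial/\partial t)^+$. Then, for all $t\in[0,t_0)$, $$\Big(\frac{\partial}{\partial t}\Big)^+\mathsf E|Y+Y_{H_t}|^q=q(q-1)\int_{\mathbb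 R}\Delta(du)\int_0^1(1-s)\,\mathsf E|su+Y+Y_{H_t}|^{q-2}\,ds .$$ If moreover $q>4$, then, for all $t\in[0,t_0)$, $$\Big(\frac{\partial^2}{\partial t^2}\Big)^+\mathsf E|Y+Y_{H_t}|^q=q(q-1)(q-2)(q-3)\int_{\mathbb R^2}\Delta(du_1)\,\Delta(du_2)\int_{(0,1)^2}(1-s_1)(1-s_2)\,\mathsf E|s_1u_1+s_2u_2+Y+Y_{H_t}|^{q-4}\,ds_1\,ds_2 .$$ Here the derivatives exist, and all the expectations and integrals are finite (absolutely convergent). Both identities also hold if the absolute-value function $x\mapsto|x|$ is replaced throughout by the positive-part function $x\mapsto x_+:=\max(0,x)$, or throughout by the negative-part function $x\mapsto x_-:=(-x)_+$. -/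

import Mathlib

open MeasureTheory ProbabilityTheory Set

noncomputable section

/-- The normalized Taylor remainder `(R_m g)(x; u)`: for `u ≠ 0` it is
`u⁻⁽ᵐ⁺¹⁾ (g (x + u) - ∑_{j ≤ m} u ^ j / j! * g⁽ʲ⁾(x))`, and for `u = 0` it is
`g⁽ᵐ⁺¹⁾(x) / (m + 1)!`. -/
def taylorRemainder (m : ℕ) (g : ℂ → ℂ) (x u : ℂ) : ℂ :=
  open scoped Classical in
  if u = 0 then iteratedDeriv (m + 1) g x / ((m + 1).factorial : ℂ)
  else (g (x + u) - ∑ j ∈ Finset.range (m + 1), u ^ j / (j.factorial : ℂ) * iteratedDeriv j g x)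
    / u ^ (m + 1)

/-- The measure `H_t = H + t Δ`, as a (finite) signed measure. -/
def perturbedMeasure (H : Measure ℝ) [IsFiniteMeasure H] (Δ : SignedMeasure ℝ) (t : ℝ) :
    SignedMeasure ℝ :=
  H.toSignedMeasure + t • Δ

/-- `IsYVariable P Z H` says that the random variable `Z` on the probability space `(Ω, P)` is a
version of `Y_H`, that is,
`E exp (i k Z) = exp (-k ^ 2 * ∫ H(du) (R_1 exp)(0; i k u))` for all real `k`.
A finite nonnegative Borel measure `H` is given here as a signed measure, so that `H + t Δ` can be
inserted directly; the integral against it is then the usual Lebesgue integral. -/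
structure IsYVariable {Ω : Type*} [MeasurableSpace Ω] (P : Measure Ω) (Z : Ω → ℝ)
    (H : SignedMeasure ℝ) : Prop where
  measurable : Measurable Z
  nonneg : 0 ≤ H
  charFun_eq : ∀ k : ℝ, charFun (P.map Z) k =
    Complex.exp (-(k : ℂ) ^ 2 *
      ∫ᵛ u, taylorRemainder 1 Complex.exp 0 (Complex.I * (k : ℂ) * ((u : ℝ) : ℂ)) ∂<•H)

/-- The three functions `x ↦ |x|`, `x ↦ x₊ = 0 ∨ x` and `x ↦ x₋ = (-x)₊`. -/
def absPosNeg : Set (ℝ → ℝ) :=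
  {fun x => |x|, fun x => max 0 x, fun x => max 0 (-x)}

end

open Filter Topology
open scoped BoundedContinuousFunction

/-! By Taylor's formula `(R_1 exp)(0; iku)` is the integral of `(1 - s) exp(iksu)` over `0 ≤ s ≤ 1`.
The exponent of `Y_H` is therefore `-k²` times the Fourier transform of a positive measure, the law
of `su` under `H(du)(1 - s)ds` (`charFun_taylorMix`). Write `B` for the signed measure built in this
way from `Δ`. The exponent of `Y_{H_t}` is affine in `t` with slope `-k² B̂(k)`, so the law `μ_t` of
`Y + Y_{H_t}` formally solves the forward equation `∂_t μ_t = (μ_t * B)''`. Tested against `g`, this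
says that `∫ g dμ_t` has derivative `∫∫ g''(x + v) B(dv) μ_t(dx)`. The choice `g = φ^q`, which is
`C²` because `q > 2`, gives the first identity. For `q > 4` the resulting `B`-average of `φ^(q-2)`
is again an admissible test function, and a second application gives the second identity.

The work lies in passing from characteristic functions to test functions of polynomial growth. No
approximation of `g` by trigonometric functions is needed. Taylor's formula writes `∫ g dμ` through
the mass, the mean and an integral of `g''` against a positive measure depending only on `μ`.
Applied to `exp(ikx)` as well, it turns an identity of characteristic functions into an identity of
measures (`integral_sub_eq_of_charFun`), whence the forward equation in integrated form. To
differentiate that form, `t ↦ ∫ h dμ_t` must be continuous for `h` of polynomial growth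
(`IsPolyPath.continuous_integral`). Lévy's theorem gives weak continuity, and moment bounds locally
uniform in `t` handle the growth. These bounds come from the smoothness of the exponent: a finite
measure with smooth characteristic function has all even moments, and they are controlled by
derivatives at `0`. -/

/-! ### Test functions of polynomial growth and measures with all moments. -/

/-- Continuous functions of at most polynomial growth. -/
structure PolyBounded (g : ℝ → ℝ) : Prop where
  continuous : Continuous g
  exists_bound : ∃ (C : ℝ) (m : ℕ), ∀ x, |g x| ≤ C * (1 + x ^ 2) ^ m

/-- Measures on the line with finite moments of all orders. -/
def PolyMoments (μ : Measure ℝ) : Prop :=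
  ∀ m : ℕ, Integrable (fun x : ℝ => (1 + x ^ 2) ^ m) μ

theorem one_le_weight (m : ℕ) (x : ℝ) : 1 ≤ (1 + x ^ 2) ^ m :=
  one_le_pow₀ (by nlinarith [sq_nonneg x])

/-- The weight is submultiplicative up to a constant, since `2(1 + x²)(1 + y²) - 1 - (x + y)² = 1 +
(x - y)² + 2x²y²`. This separates the variables in every bound on translates and convolutions. -/
theorem weight_add_le (m : ℕ) (x y : ℝ) :
    (1 + (x + y) ^ 2) ^ m ≤ 2 ^ m * ((1 + x ^ 2) ^ m * (1 + y ^ 2) ^ m) := by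
  rw [← mul_pow, ← mul_pow]
  refine pow_le_pow_left₀ (by positivity) ?_ m
  nlinarith [sq_nonneg (x - y), sq_nonneg (x * y)]

theorem weight_mul_le (m : ℕ) {s : ℝ} (hs : |s| ≤ 1) (x : ℝ) :
    (1 + (s * x) ^ 2) ^ m ≤ (1 + x ^ 2) ^ m := by
  refine pow_le_pow_left₀ (by positivity) ?_ m
  have : s ^ 2 ≤ 1 := by rw [← sq_abs]; nlinarith [abs_nonneg s]
  nlinarith [sq_nonneg x]

namespace PolyBounded

theorem exists_nonneg_bound {g : ℝ → ℝ} (hg : PolyBounded g) :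
    ∃ (C : ℝ) (m : ℕ), 0 ≤ C ∧ ∀ x, |g x| ≤ C * (1 + x ^ 2) ^ m := by
  obtain ⟨C, m, h⟩ := hg.exists_bound
  refine ⟨C, m, ?_, h⟩
  have := h 0
  simp at this
  exact (abs_nonneg _).trans this

theorem mono_exponent {C : ℝ} {m n : ℕ} (hC : 0 ≤ C) (hmn : m ≤ n) (x : ℝ) :
    C * (1 + x ^ 2) ^ m ≤ C * (1 + x ^ 2) ^ n := by
  gcongr
  nlinarith [sq_nonneg x]

theorem add {f g : ℝ → ℝ} (hf : PolyBounded f) (hg : PolyBounded g) :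
    PolyBounded (fun x => f x + g x) := by
  refine ⟨hf.continuous.add hg.continuous, ?_⟩
  obtain ⟨C, m, hC, h⟩ := hf.exists_nonneg_bound
  obtain ⟨D, n, hD, h'⟩ := hg.exists_nonneg_bound
  refine ⟨C + D, m + n, fun x => (abs_add_le _ _).trans ?_⟩
  rw [add_mul]
  exact add_le_add ((h x).trans (mono_exponent hC (by omega) x))
    ((h' x).trans (mono_exponent hD (by omega) x))

theorem const_mul {f : ℝ → ℝ} (hf : PolyBounded f) (c : ℝ) : PolyBounded (fun x => c * f x) := by
  refine ⟨hf.continuous.const_mul c, ?_⟩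
  obtain ⟨C, m, h⟩ := hf.exists_bound
  refine ⟨|c| * C, m, fun x => ?_⟩
  rw [abs_mul, mul_assoc]
  exact mul_le_mul_of_nonneg_left (h x) (abs_nonneg c)

theorem sub {f g : ℝ → ℝ} (hf : PolyBounded f) (hg : PolyBounded g) :
    PolyBounded (fun x => f x - g x) := by
  simpa [sub_eq_add_neg] using hf.add (hg.const_mul (-1))

theorem sq {f : ℝ → ℝ} (hf : PolyBounded f) : PolyBounded (fun x => f x ^ 2) := by
  refine ⟨hf.continuous.pow 2, ?_⟩
  obtain ⟨C, m, hC, h⟩ := hf.exists_nonneg_bound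
  refine ⟨C ^ 2, m * 2, fun x => ?_⟩
  rw [abs_pow, pow_mul, ← mul_pow]
  exact pow_le_pow_left₀ (abs_nonneg _) (h x) 2

theorem integrable {g : ℝ → ℝ} (hg : PolyBounded g) {μ : Measure ℝ} (hμ : PolyMoments μ) :
    Integrable g μ := by
  obtain ⟨C, m, h⟩ := hg.exists_bound
  exact ((hμ m).const_mul C).mono' hg.continuous.aestronglyMeasurable
    (Filter.Eventually.of_forall h)

theorem exists_bound_add {g : ℝ → ℝ} (hg : PolyBounded g) :
    ∃ (C : ℝ) (m : ℕ), 0 ≤ C ∧ ∀ x y, |g (x + y)| ≤ C * ((1 + x ^ 2) ^ m * (1 + y ^ 2) ^ m) := by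
  obtain ⟨C, m, hC, h⟩ := hg.exists_nonneg_bound
  refine ⟨C * 2 ^ m, m, by positivity, fun x y => (h _).trans ?_⟩
  rw [mul_assoc]
  exact mul_le_mul_of_nonneg_left (weight_add_le m x y) hC

theorem integrable_add_left {g : ℝ → ℝ} (hg : PolyBounded g) {μ : Measure ℝ}
    (hμ : PolyMoments μ) (x : ℝ) : Integrable (fun v => g (x + v)) μ := by
  obtain ⟨C, m, hC, h⟩ := hg.exists_bound_add
  refine ((hμ m).const_mul (C * (1 + x ^ 2) ^ m)).mono'
    (hg.continuous.comp (by fun_prop)).aestronglyMeasurable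
    (Filter.Eventually.of_forall fun v => ?_)
  rw [mul_assoc]
  exact h x v

theorem integrable_prod_add {g : ℝ → ℝ} (hg : PolyBounded g) {μ ν : Measure ℝ} [SFinite μ]
    [SFinite ν] (hμ : PolyMoments μ) (hν : PolyMoments ν) :
    Integrable (fun p : ℝ × ℝ => g (p.1 + p.2)) (μ.prod ν) := by
  obtain ⟨C, m, hC, h⟩ := hg.exists_bound_add
  exact (((hμ m).mul_prod (hν m)).const_mul C).mono'
    (hg.continuous.comp (by fun_prop)).aestronglyMeasurable
    (Filter.Eventually.of_forall fun p => h p.1 p.2)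

/-- Averaging over translates preserves polynomial growth. -/
theorem integral_add {g : ℝ → ℝ} (hg : PolyBounded g) {μ : Measure ℝ} (hμ : PolyMoments μ) :
    PolyBounded (fun x => ∫ v, g (x + v) ∂μ) := by
  obtain ⟨C, m, hC, h⟩ := hg.exists_bound_add
  refine ⟨continuous_iff_continuousAt.2 fun x₀ => ?_, ?_⟩
  · refine continuousAt_of_dominated
      (bound := fun v => C * ((1 + (|x₀| + 1) ^ 2) ^ m * (1 + v ^ 2) ^ m)) ?_ ?_ ?_ ?_
    · exact Filter.Eventually.of_forall fun x =>
        (hg.continuous.comp (by fun_prop)).aestronglyMeasurable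
    · filter_upwards [Metric.ball_mem_nhds x₀ one_pos] with x hx
      refine Filter.Eventually.of_forall fun v => (h x v).trans ?_
      have hx' : |x| ≤ |x₀| + 1 := by
        rw [Metric.mem_ball, Real.dist_eq] at hx
        have := abs_add_le (x - x₀) x₀
        simp only [sub_add_cancel] at this
        linarith
      gcongr C * (?_ ^ m * _)
      nlinarith [sq_abs x, abs_nonneg x, abs_nonneg x₀]
    · exact ((hμ m).const_mul _).const_mul C
    · exact Filter.Eventually.of_forall fun v =>
        (hg.continuous.comp (by fun_prop : Continuous fun x : ℝ => x + v)).continuousAt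
  · refine ⟨C * ∫ v, (1 + v ^ 2) ^ m ∂μ, m, fun x => ?_⟩
    calc |∫ v, g (x + v) ∂μ| ≤ ∫ v, C * ((1 + x ^ 2) ^ m * (1 + v ^ 2) ^ m) ∂μ :=
          norm_integral_le_of_norm_le (f := fun v => g (x + v))
            (((hμ m).const_mul ((1 + x ^ 2) ^ m)).const_mul C)
            (Filter.Eventually.of_forall fun v => h x v)
      _ = _ := by rw [integral_const_mul, integral_const_mul]; ring

/-- Differentiation under the integral, dominated on the unit ball around `x₀`. It makes averages of
smooth functions admissible as test functions for the second derivative. -/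
theorem hasDerivAt_integral_add {g g' : ℝ → ℝ} (hg : PolyBounded g) (hg' : PolyBounded g')
    (hd : ∀ x, HasDerivAt g (g' x) x) {μ : Measure ℝ} (hμ : PolyMoments μ) (x₀ : ℝ) :
    HasDerivAt (fun x => ∫ v, g (x + v) ∂μ) (∫ v, g' (x₀ + v) ∂μ) x₀ := by
  obtain ⟨C, m, hC, h⟩ := hg'.exists_bound_add
  refine (hasDerivAt_integral_of_dominated_loc_of_deriv_le (F := fun x v => g (x + v))
      (F' := fun x v => g' (x + v))
      (bound := fun v => C * ((1 + (|x₀| + 1) ^ 2) ^ m * (1 + v ^ 2) ^ m))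
      (Metric.ball_mem_nhds x₀ one_pos) ?_ (hg.integrable_add_left hμ x₀) ?_ ?_ ?_ ?_).2
  · exact Filter.Eventually.of_forall fun x =>
      (hg.continuous.comp (by fun_prop)).aestronglyMeasurable
  · exact (hg'.continuous.comp (by fun_prop)).aestronglyMeasurable
  · refine Filter.Eventually.of_forall fun v x hx => (h x v).trans ?_
    have hx' : |x| ≤ |x₀| + 1 := by
      rw [Metric.mem_ball, Real.dist_eq] at hx
      have := abs_add_le (x - x₀) x₀
      simp only [sub_add_cancel] at this
      linarith
    gcongr C * (?_ ^ m * _)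
    nlinarith [sq_abs x, abs_nonneg x, abs_nonneg x₀]
  · exact ((hμ m).const_mul _).const_mul C
  · exact Filter.Eventually.of_forall fun v x _ => (hd (x + v)).comp_add_const x v

end PolyBounded

theorem polyBounded_weight (m : ℕ) : PolyBounded (fun x => (1 + x ^ 2) ^ m) :=
  ⟨by fun_prop, 1, m, fun x => by rw [abs_of_nonneg (by positivity), one_mul]⟩

theorem polyBounded_id : PolyBounded (fun x => x) :=
  ⟨continuous_id, 1, 1, fun x => by
    rw [pow_one, one_mul]; nlinarith [sq_abs x, sq_nonneg (|x| - 1), abs_nonneg x]⟩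

/-- Powers of functions dominated by the identity have polynomial growth. -/
theorem polyBounded_rpow {φ : ℝ → ℝ} (hφ : Continuous φ) (h0 : ∀ x, 0 ≤ φ x)
    (hle : ∀ x, φ x ≤ |x|) {p : ℝ} (hp : 0 ≤ p) : PolyBounded (fun x => φ x ^ p) := by
  refine ⟨hφ.rpow_const fun x => Or.inr hp, 1, ⌈p⌉₊, fun x => ?_⟩
  rw [abs_of_nonneg (Real.rpow_nonneg (h0 x) p), one_mul]
  have h1 : (1 : ℝ) ≤ 1 + x ^ 2 := by nlinarith [sq_nonneg x]
  have h2 : φ x ≤ 1 + x ^ 2 := (hle x).trans (by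
    nlinarith [sq_abs x, sq_nonneg (|x| - 1), abs_nonneg x])
  calc φ x ^ p ≤ (1 + x ^ 2) ^ p := Real.rpow_le_rpow (h0 x) h2 hp
    _ ≤ (1 + x ^ 2) ^ ((⌈p⌉₊ : ℕ) : ℝ) := Real.rpow_le_rpow_of_exponent_le h1 (Nat.le_ceil p)
    _ = _ := Real.rpow_natCast _ _

namespace PolyMoments

theorem isFiniteMeasure {μ : Measure ℝ} (hμ : PolyMoments μ) : IsFiniteMeasure μ := by
  have := hμ 0
  simp only [pow_zero] at this
  exact (integrable_const_iff_isFiniteMeasure one_ne_zero).1 this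

theorem mono {μ ν : Measure ℝ} (hν : PolyMoments ν) (h : μ ≤ ν) : PolyMoments μ :=
  fun m => (hν m).mono_measure h

theorem conv {μ ν : Measure ℝ} [SFinite μ] [SFinite ν] (hμ : PolyMoments μ)
    (hν : PolyMoments ν) : PolyMoments (μ ∗ ν) := fun m => by
  rw [Measure.conv, integrable_map_measure (by fun_prop) (by fun_prop)]
  exact (polyBounded_weight m).integrable_prod_add hμ hν

theorem withDensity_sq {μ : Measure ℝ} (hμ : PolyMoments μ) :
    PolyMoments (μ.withDensity fun x => ENNReal.ofReal (x ^ 2)) := fun m => by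
  rw [integrable_withDensity_iff_integrable_smul' (by fun_prop) (by simp)]
  refine (hμ (m + 1)).mono' (by fun_prop) (Filter.Eventually.of_forall fun x => ?_)
  rw [ENNReal.toReal_ofReal (sq_nonneg x), smul_eq_mul, Real.norm_of_nonneg (by positivity),
    pow_succ _ m]
  nlinarith [one_le_weight m x]

theorem memLp_id {μ : Measure ℝ} (hμ : PolyMoments μ) (k : ℕ) : MemLp id k μ := by
  have := hμ.isFiniteMeasure
  rcases Nat.eq_zero_or_pos k with rfl | hk
  · simpa using by fun_prop
  rw [← integrable_norm_rpow_iff (by fun_prop) (by positivity) (by simp)]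
  refine (polyBounded_rpow continuous_abs abs_nonneg (fun _ => le_rfl)
    (Nat.cast_nonneg k)).integrable hμ |>.congr (Filter.Eventually.of_forall fun x => ?_)
  simp

/-- A single term of the exponential series at `σ(1 + |u|)` dominates the weight. The exponential
moment enters the argument only here. -/
theorem of_lintegral_exp {μ : Measure ℝ} {σ : ℝ} (hσ : 0 < σ)
    (h : ∫⁻ u, ENNReal.ofReal (Real.exp (σ * |u|)) ∂μ < ⊤) : PolyMoments μ := fun m => by
  have hi : Integrable (fun u => Real.exp (σ * |u|)) μ :=
    ⟨by fun_prop, by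
      rw [hasFiniteIntegral_iff_ofReal (Filter.Eventually.of_forall fun _ => (Real.exp_pos _).le)]
      exact h⟩
  refine (hi.const_mul (((2 * m).factorial : ℝ) * Real.exp σ / σ ^ (2 * m))).mono'
    (by fun_prop) (Filter.Eventually.of_forall fun u => ?_)
  rw [Real.norm_of_nonneg (by positivity), div_mul_eq_mul_div, le_div_iff₀ (by positivity)]
  have h1 := Real.pow_div_factorial_le_exp (σ * (1 + |u|)) (by positivity) (2 * m)
  rw [div_le_iff₀ (by positivity)] at h1
  calc (1 + u ^ 2) ^ m * σ ^ (2 * m) ≤ ((1 + |u|) ^ 2) ^ m * σ ^ (2 * m) := by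
        gcongr
        nlinarith [sq_abs u, abs_nonneg u]
    _ = (σ * (1 + |u|)) ^ (2 * m) := by rw [← pow_mul, mul_pow, mul_comm]
    _ ≤ _ := h1
    _ = _ := by rw [mul_add, mul_one, Real.exp_add]; ring

end PolyMoments

/-! ### The triangular mixture and the Taylor remainder of the exponential. -/

/-- The measure `(1 - s) ds` on `(0, 1]`. -/
noncomputable def triangleMeasure : Measure ℝ :=
  (volume.restrict (Ioc 0 1)).withDensity fun s => ENNReal.ofReal (1 - s)

theorem ae_restrict_Ioc_toReal :
    ∀ᵐ s ∂(volume.restrict (Ioc (0 : ℝ) 1)), (ENNReal.ofReal (1 - s)).toReal = 1 - s := by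
  filter_upwards [ae_restrict_mem measurableSet_Ioc] with s hs
  exact ENNReal.toReal_ofReal (by linarith [hs.2])

theorem ae_triangleMeasure : ∀ᵐ s ∂triangleMeasure, s ∈ Ioc (0 : ℝ) 1 :=
  (withDensity_absolutelyContinuous _ _).ae_le (ae_restrict_mem measurableSet_Ioc)

theorem integral_triangleMeasure {E : Type*} [NormedAddCommGroup E] [NormedSpace ℝ E]
    (f : ℝ → E) : ∫ s, f s ∂triangleMeasure = ∫ s in (0 : ℝ)..1, (1 - s) • f s := by
  rw [triangleMeasure, integral_withDensity_eq_integral_toReal_smul (by fun_prop) (by simp),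
    intervalIntegral.integral_of_le zero_le_one]
  refine integral_congr_ae ?_
  filter_upwards [ae_restrict_Ioc_toReal] with s hs
  rw [hs]

theorem integrable_triangleMeasure_iff {E : Type*} [NormedAddCommGroup E] [NormedSpace ℝ E]
    (f : ℝ → E) : Integrable f triangleMeasure ↔
      Integrable (fun s => (1 - s) • f s) (volume.restrict (Ioc 0 1)) := by
  rw [triangleMeasure, integrable_withDensity_iff_integrable_smul' (by fun_prop) (by simp)]
  refine integrable_congr ?_
  filter_upwards [ae_restrict_Ioc_toReal] with s hs
  rw [hs]

instance : IsFiniteMeasure triangleMeasure := by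
  rw [← integrable_const_iff_isFiniteMeasure (one_ne_zero (α := ℝ)),
    integrable_triangleMeasure_iff]
  exact (by fun_prop : Continuous fun s : ℝ => (1 - s) • (1 : ℝ)).integrableOn_Ioc

/-- The law of `s * u` under `μ(du) (1 - s) ds`, `0 < s ≤ 1`. -/
noncomputable def taylorMix (μ : Measure ℝ) : Measure ℝ :=
  (μ.prod triangleMeasure).map fun p => p.2 * p.1

instance (μ : Measure ℝ) [IsFiniteMeasure μ] : IsFiniteMeasure (taylorMix μ) := by
  unfold taylorMix; infer_instance

theorem PolyMoments.taylorMix {μ : Measure ℝ} (hμ : PolyMoments μ) :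
    PolyMoments (taylorMix μ) := fun m => by
  have := hμ.isFiniteMeasure
  rw [_root_.taylorMix, integrable_map_measure (by fun_prop) (by fun_prop)]
  refine ((hμ m).mul_prod (integrable_const (1 : ℝ) (μ := triangleMeasure))).mono'
    (by fun_prop) ?_
  have h2 : ∀ᵐ p ∂(μ.prod triangleMeasure), p.2 ∈ Ioc (0 : ℝ) 1 :=
    Measure.quasiMeasurePreserving_snd.ae ae_triangleMeasure
  filter_upwards [h2] with p hp
  simp only [Function.comp, mul_one]
  rw [Real.norm_of_nonneg (by positivity)]
  exact weight_mul_le m (abs_le.2 ⟨by linarith [hp.1], hp.2⟩) _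

theorem integral_taylorMix {E : Type*} [NormedAddCommGroup E] [NormedSpace ℝ E]
    {μ : Measure ℝ} [IsFiniteMeasure μ] {g : ℝ → E}
    (hg : Integrable g (taylorMix μ)) :
    ∫ v, g v ∂(taylorMix μ) = ∫ u, (∫ s in (0 : ℝ)..1, (1 - s) • g (s * u)) ∂μ := by
  have hm : Measurable fun p : ℝ × ℝ => p.2 * p.1 := by fun_prop
  unfold taylorMix at hg ⊢
  rw [integral_map hm.aemeasurable hg.1, integral_prod]
  · simp_rw [integral_triangleMeasure]
  · exact (integrable_map_measure hg.1 hm.aemeasurable).1 hg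

theorem taylorRemainder_one_exp (z : ℂ) :
    taylorRemainder 1 Complex.exp 0 z = ∫ s in (0 : ℝ)..1, (1 - s) • Complex.exp (s * z) := by
  unfold taylorRemainder
  split_ifs with h
  · subst h
    simp only [mul_zero, Complex.exp_zero, iteratedDeriv_eq_iterate, Complex.iter_deriv_exp]
    rw [intervalIntegral.integral_smul_const, intervalIntegral.integral_sub (by simp) (by simp)]
    simp
    norm_num
  -- The function below is an explicit antiderivative of `(1 - s) exp(sz)`; its increment over `[0,
  -- 1]` is the remainder.
  · have hd : ∀ s ∈ uIcc (0 : ℝ) 1, HasDerivAt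
        (fun s : ℝ => Complex.exp (s * z) * ((1 - s) / z + 1 / z ^ 2))
        ((1 - s) • Complex.exp (s * z)) s := fun s _ => by
      have h1 : HasDerivAt (fun s : ℝ => Complex.exp (s * z)) (Complex.exp (s * z) * z) s := by
        have := ((hasDerivAt_id s).ofReal_comp.mul_const z).cexp
        simpa using this
      have h2 : HasDerivAt (fun s : ℝ => (1 - (s : ℂ)) / z + 1 / z ^ 2) (-1 / z) s := by
        have := (((hasDerivAt_id s).ofReal_comp.const_sub 1).div_const z).add_const (1 / z ^ 2)
        simpa using this
      refine (h1.mul h2).congr_deriv ?_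
      rw [Complex.real_smul]
      push_cast
      field_simp
      ring
    rw [intervalIntegral.integral_eq_sub_of_hasDerivAt hd
      (by apply Continuous.intervalIntegrable; fun_prop)]
    simp [Finset.sum_range_succ, iteratedDeriv_eq_iterate, Complex.iter_deriv_exp]
    field_simp
    ring

/-- Fubini with the integral form of the remainder. The exponent of `Y_H` thus becomes `-k²` times
the Fourier transform of a positive measure. -/
theorem charFun_taylorMix {μ : Measure ℝ} [IsFiniteMeasure μ] (k : ℝ) :
    charFun (taylorMix μ) k =
      ∫ u, taylorRemainder 1 Complex.exp 0 (Complex.I * (k : ℂ) * ((u : ℝ) : ℂ)) ∂μ := by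
  rw [charFun_apply_real, integral_taylorMix]
  · refine integral_congr_ae (Filter.Eventually.of_forall fun u => ?_)
    simp only [taylorRemainder_one_exp]
    apply intervalIntegral.integral_congr
    intro s _
    simp only
    congr 2
    push_cast
    ring
  · refine Integrable.of_bound (by fun_prop) 1 (Filter.Eventually.of_forall fun x => ?_)
    rw [← Complex.ofReal_mul, Complex.norm_exp_ofReal_mul_I]

theorem continuous_taylorRemainder_one_exp : Continuous (taylorRemainder 1 Complex.exp 0) := by
  rw [funext taylorRemainder_one_exp]
  exact intervalIntegral.continuous_parametric_intervalIntegral_of_continuous' (by fun_prop) 0 1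

theorem norm_taylorRemainder_le (k u : ℝ) :
    ‖taylorRemainder 1 Complex.exp 0 (Complex.I * (k : ℂ) * ((u : ℝ) : ℂ))‖ ≤ 1 := by
  rw [taylorRemainder_one_exp]
  refine (intervalIntegral.norm_integral_le_of_norm_le_const (C := 1) fun s hs => ?_).trans
    (by simp)
  rw [uIoc_of_le zero_le_one] at hs
  have : (s : ℂ) * (Complex.I * k * u) = ((s * k * u : ℝ) : ℂ) * Complex.I := by
    push_cast; ring
  rw [norm_smul, this, Complex.norm_exp_ofReal_mul_I, mul_one, Real.norm_of_nonneg (by linarith [hs.2])]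
  linarith [hs.1]

theorem integrable_taylorRemainder (μ : Measure ℝ) [IsFiniteMeasure μ] (k : ℝ) :
    Integrable (fun u : ℝ =>
      taylorRemainder 1 Complex.exp 0 (Complex.I * (k : ℂ) * ((u : ℝ) : ℂ))) μ :=
  Integrable.of_bound
    (continuous_taylorRemainder_one_exp.comp (by fun_prop)).aestronglyMeasurable 1
    (Filter.Eventually.of_forall fun u => norm_taylorRemainder_le k u)

/-! ### From characteristic functions to smooth test functions. -/

/-- The measure `K` such that `∫ g dμ = g(0) μ(ℝ) + g'(0) ∫ x μ(dx) + ∫ g'' dK`. -/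
noncomputable def secondMix (μ : Measure ℝ) : Measure ℝ :=
  taylorMix (μ.withDensity fun x => ENNReal.ofReal (x ^ 2))

theorem PolyMoments.secondMix {μ : Measure ℝ} (hμ : PolyMoments μ) :
    PolyMoments (secondMix μ) :=
  hμ.withDensity_sq.taylorMix

theorem eq_taylor_integral {g g' g'' : ℝ → ℝ} (h1 : ∀ x, HasDerivAt g (g' x) x)
    (h2 : ∀ x, HasDerivAt g' (g'' x) x) (hc : Continuous g'') (x : ℝ) :
    g x = g 0 + g' 0 * x + x ^ 2 * ∫ s in (0 : ℝ)..1, (1 - s) • g'' (s * x) := by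
  -- This antiderivative runs from `g 0 + x g' 0` at `s = 0` to `g x` at `s = 1`.
  have hd : ∀ s ∈ uIcc (0 : ℝ) 1, HasDerivAt (fun s => g (s * x) + (1 - s) * (x * g' (s * x)))
      (x ^ 2 * ((1 - s) • g'' (s * x))) s := fun s _ => by
    have e : HasDerivAt (fun s : ℝ => s * x) x s := by simpa using (hasDerivAt_id s).mul_const x
    have e1 := (h1 (s * x)).comp s e
    have e2 := ((h2 (s * x)).comp s e).const_mul x
    have e3 := ((hasDerivAt_id s).const_sub 1).mul e2
    refine (e1.add e3).congr_deriv ?_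
    simp only [id, smul_eq_mul, Function.comp]
    ring
  have := intervalIntegral.integral_eq_sub_of_hasDerivAt hd
    (by apply Continuous.intervalIntegrable; fun_prop)
  rw [intervalIntegral.integral_const_mul] at this
  rw [this]
  simp
  ring

theorem integral_eq_secondMix {g g' g'' : ℝ → ℝ} (h1 : ∀ x, HasDerivAt g (g' x) x)
    (h2 : ∀ x, HasDerivAt g' (g'' x) x) (hg : PolyBounded g) (hg'' : PolyBounded g'')
    {μ : Measure ℝ} (hμ : PolyMoments μ) :
    ∫ x, g x ∂μ = g 0 * μ.real univ + g' 0 * ∫ x, x ∂μ + ∫ x, g'' x ∂(secondMix μ) := by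
  have := hμ.isFiniteMeasure
  have := hμ.withDensity_sq.isFiniteMeasure
  have hi0 : Integrable (fun x => g 0 + g' 0 * x) μ :=
    (integrable_const _).add ((polyBounded_id.integrable hμ).const_mul _)
  -- The remainder is integrable as the difference of `g` and its first-order expansion.
  have hi1 : Integrable (fun x => x ^ 2 * ∫ s in (0 : ℝ)..1, (1 - s) • g'' (s * x)) μ := by
    refine ((hg.integrable hμ).sub hi0).congr (Filter.Eventually.of_forall fun x => ?_)
    change g x - (g 0 + g' 0 * x) = _
    rw [eq_taylor_integral h1 h2 hg''.continuous x]
    ring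
  rw [integral_congr_ae (Filter.Eventually.of_forall fun x =>
    eq_taylor_integral h1 h2 hg''.continuous x), integral_add hi0 hi1,
    integral_add (integrable_const _) ((polyBounded_id.integrable hμ).const_mul _),
    integral_const_mul, integral_const, smul_eq_mul, mul_comm (μ.real univ), secondMix,
    integral_taylorMix (hg''.integrable hμ.secondMix),
    integral_withDensity_eq_integral_toReal_smul (by fun_prop) (by simp)]
  congr 1
  refine integral_congr_ae (Filter.Eventually.of_forall fun x => ?_)
  simp only [ENNReal.toReal_ofReal (sq_nonneg x), smul_eq_mul]

/-- The same expansion for the test function `exp(ikx)`. The same measure `secondMix μ` appears in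
both, so what is learnt about it from characteristic functions transfers to all smooth `g`. -/
theorem charFun_eq_secondMix {μ : Measure ℝ} (hμ : PolyMoments μ) (k : ℝ) :
    charFun μ k = μ.real univ + Complex.I * k * (∫ x, x ∂μ : ℝ) - k ^ 2 * charFun (secondMix μ) k := by
  have := hμ.isFiniteMeasure
  have := hμ.withDensity_sq.isFiniteMeasure
  have hz : ∀ z : ℂ, Complex.exp z = 1 + z + z ^ 2 * taylorRemainder 1 Complex.exp 0 z := by
    intro z
    unfold taylorRemainder
    split_ifs with h
    · simp [h]
    · simp [Finset.sum_range_succ, iteratedDeriv_eq_iterate, Complex.iter_deriv_exp]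
      field_simp
      ring
  have hi0 : Integrable (fun x : ℝ => 1 + Complex.I * k * (x : ℂ)) μ :=
    (integrable_const _).add ((polyBounded_id.integrable hμ).ofReal.const_mul _)
  have hi1 : Integrable (fun x : ℝ => (x ^ 2 : ℝ) •
      taylorRemainder 1 Complex.exp 0 (Complex.I * (k : ℂ) * (x : ℂ))) μ := by
    have := integrable_taylorRemainder (μ.withDensity fun x => ENNReal.ofReal (x ^ 2)) k
    rw [integrable_withDensity_iff_integrable_smul' (by fun_prop) (by simp)] at this
    simpa only [ENNReal.toReal_ofReal (sq_nonneg _)] using this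
  have e : ∀ x : ℝ, Complex.exp (k * x * Complex.I) = (1 + Complex.I * k * (x : ℂ)) +
      -(k : ℂ) ^ 2 * ((x ^ 2 : ℝ) •
        taylorRemainder 1 Complex.exp 0 (Complex.I * (k : ℂ) * (x : ℂ))) := by
    intro x
    rw [show (k : ℂ) * x * Complex.I = Complex.I * k * x by ring, hz (Complex.I * k * x)]
    simp only [Complex.real_smul, mul_pow, Complex.I_sq]
    push_cast
    ring
  rw [charFun_apply_real, integral_congr_ae (Filter.Eventually.of_forall e),
    integral_add hi0 (hi1.const_mul _),
    integral_add (integrable_const _) ((polyBounded_id.integrable hμ).ofReal.const_mul _),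
    integral_const_mul, integral_const_mul, integral_const, secondMix, charFun_taylorMix,
    integral_withDensity_eq_integral_toReal_smul (by fun_prop) (by simp)]
  have hr : ∫ x : ℝ, (x : ℂ) ∂μ = ((∫ x, x ∂μ : ℝ) : ℂ) := integral_complex_ofReal
  simp only [ENNReal.toReal_ofReal (sq_nonneg _), hr]
  simp
  ring

theorem charFun_add_measure {μ ν : Measure ℝ} [IsFiniteMeasure μ] [IsFiniteMeasure ν] (k : ℝ) :
    charFun (μ + ν) k = charFun μ k + charFun ν k := by
  have h : ∀ ρ : Measure ℝ, [IsFiniteMeasure ρ] →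
      Integrable (fun x : ℝ => Complex.exp (k * x * Complex.I)) ρ := fun ρ _ =>
    Integrable.of_bound (by fun_prop) 1 (Filter.Eventually.of_forall fun x => by
      rw [← Complex.ofReal_mul, Complex.norm_exp_ofReal_mul_I])
  simp only [charFun_apply_real]
  exact integral_add_measure (h μ) (h ν)

/-- If the characteristic functions of two laws differ by `-k²` times that of a signed measure,
then integrals of smooth functions differ by the integral of the second derivative. -/
theorem integral_sub_eq_of_charFun {μ₁ μ₂ N₁ N₂ : Measure ℝ} [IsProbabilityMeasure μ₁]
    [IsProbabilityMeasure μ₂] (h1 : PolyMoments μ₁) (h2 : PolyMoments μ₂) (hN1 : PolyMoments N₁)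
    (hN2 : PolyMoments N₂)
    (hc : ∀ k : ℝ, charFun μ₁ k - charFun μ₂ k = -(k : ℂ) ^ 2 * (charFun N₁ k - charFun N₂ k))
    {g g' g'' : ℝ → ℝ} (hd1 : ∀ x, HasDerivAt g (g' x) x)
    (hd2 : ∀ x, HasDerivAt g' (g'' x) x) (hg : PolyBounded g) (hg'' : PolyBounded g'') :
    ∫ x, g x ∂μ₁ - ∫ x, g x ∂μ₂ = ∫ x, g'' x ∂N₁ - ∫ x, g'' x ∂N₂ := by
  have := hN1.isFiniteMeasure
  have := hN2.isFiniteMeasure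
  have := h1.secondMix.isFiniteMeasure
  have := h2.secondMix.isFiniteMeasure
  -- The aim is `a = 0` and `c = 0`: equality of the means, and equality of the second-order
  -- measures up to `N₁ - N₂`.
  set a : ℝ := ∫ x, x ∂μ₁ - ∫ x, x ∂μ₂ with ha
  set c : ℝ → ℂ := fun k => charFun (secondMix μ₁) k - charFun (secondMix μ₂) k -
    (charFun N₁ k - charFun N₂ k) with hcdef
  have hcc : Continuous c := by fun_prop
  have key : ∀ k : ℝ, Complex.I * a * k = k ^ 2 * c k := by
    intro k
    have := hc k
    rw [charFun_eq_secondMix h1, charFun_eq_secondMix h2] at this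
    simp only [probReal_univ] at this
    rw [hcdef, ha]
    push_cast
    linear_combination this
  -- Division by `k` is legitimate off `0`, and continuity restores the identity at `0`, where it
  -- forces `a = 0`. A second division then gives `c = 0`.
  have key2 : ∀ k : ℝ, Complex.I * a = k * c k := by
    have hcl : Dense {k : ℝ | k ≠ 0} := dense_compl_singleton 0
    have := Continuous.ext_on hcl (f := fun _ : ℝ => Complex.I * a) (g := fun k : ℝ => k * c k)
      (by fun_prop) (by fun_prop) (fun k hk => by
        have hk' : (k : ℂ) ≠ 0 := by exact_mod_cast hk
        apply mul_right_cancel₀ hk'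
        simp only
        rw [key k]; ring)
    exact fun k => congrFun this k
  have ha0 : a = 0 := by simpa using key2 0
  have hc0 : ∀ k, c k = 0 := by
    have hcl : Dense {k : ℝ | k ≠ 0} := dense_compl_singleton 0
    have := Continuous.ext_on hcl (f := c) (g := fun _ => 0)
      (by fun_prop) (by fun_prop) (fun k hk => by
        have hk' : (k : ℂ) ≠ 0 := by exact_mod_cast hk
        have := key2 k
        rw [ha0] at this
        simpa [hk'] using this.symm)
    exact fun k => congrFun this k
  -- The negative terms are moved across so that uniqueness of characteristic functions applies to
  -- positive finite measures.
  have hm : secondMix μ₁ + N₂ = secondMix μ₂ + N₁ := by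
    refine Measure.ext_of_charFun (funext fun k => ?_)
    rw [charFun_add_measure, charFun_add_measure]
    have := hc0 k
    simp only [hcdef] at this
    linear_combination this
  have hI : ∫ x, g'' x ∂(secondMix μ₁) + ∫ x, g'' x ∂N₂ =
      ∫ x, g'' x ∂(secondMix μ₂) + ∫ x, g'' x ∂N₁ := by
    rw [← integral_add_measure (hg''.integrable h1.secondMix) (hg''.integrable hN2), hm,
      integral_add_measure (hg''.integrable h2.secondMix) (hg''.integrable hN1)]
  rw [integral_eq_secondMix hd1 hd2 hg hg'' h1, integral_eq_secondMix hd1 hd2 hg hg'' h2]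
  simp only [probReal_univ]
  have : g' 0 * ∫ x, x ∂μ₁ = g' 0 * ∫ x, x ∂μ₂ := by
    rw [sub_eq_zero.1 (ha.symm.trans ha0)]
  linarith

/-! ### Moments from smoothness of the characteristic function. -/

/-- A finite measure whose characteristic function is `C²` has a finite second moment. -/
theorem integrable_sq_of_contDiff_charFun {ρ : Measure ℝ} [IsFiniteMeasure ρ]
    (h : ContDiff ℝ 2 (charFun ρ)) : Integrable (fun x : ℝ => x ^ 2) ρ := by
  -- Symmetrising kills the first derivative at `0` and makes `f 0 - f k` the integral of the
  -- nonnegative function `2 - 2 cos(kx)`. Taylor's bound makes this integral at most a multiple of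
  -- `k²`.
  set f : ℝ → ℂ := fun k => charFun ρ k + charFun ρ (-k) with hf
  have hfc : ContDiff ℝ 2 f := h.add (h.comp contDiff_neg)
  have hd : deriv f 0 = 0 := by
    have h1 : HasDerivAt (charFun ρ) (deriv (charFun ρ) 0) 0 :=
      (h.differentiable (by norm_num) 0).hasDerivAt
    have h2 : HasDerivAt (fun k => charFun ρ (-k)) (-deriv (charFun ρ) 0) 0 := by
      have h1' : HasDerivAt (charFun ρ) (deriv (charFun ρ) 0) (-0) := by simpa using h1
      exact (h1'.scomp (0 : ℝ) (hasDerivAt_neg (0 : ℝ))).congr_deriv (by simp)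
    exact (h1.add h2).deriv.trans (add_neg_cancel _)
  obtain ⟨C, hC⟩ := exists_taylor_mean_remainder_bound (f := f) (n := 1) (zero_le_one)
    (hfc.contDiffOn.of_le (by norm_num))
  have hdw : derivWithin f (Icc 0 1) 0 = 0 := by
    rw [(hfc.differentiable (by norm_num) 0).derivWithin
      (uniqueDiffOn_Icc zero_lt_one 0 (by simp)), hd]
  have hre : ∀ k : ℝ, ∫ x, (2 - 2 * Real.cos (k * x)) ∂ρ = (f 0 - f k).re := by
    intro k
    have e : ∀ k x : ℝ, (Complex.exp (k * x * Complex.I)).re = Real.cos (k * x) := fun k x => by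
      rw [← Complex.ofReal_mul, Complex.exp_ofReal_mul_I_re]
    have hi : ∀ k : ℝ, Integrable (fun x : ℝ => Complex.exp (k * x * Complex.I)) ρ := fun k =>
      Integrable.of_bound (by fun_prop) 1 (Filter.Eventually.of_forall fun x => by
        rw [← Complex.ofReal_mul, Complex.norm_exp_ofReal_mul_I])
    have hcos : ∀ k : ℝ, (charFun ρ k).re = ∫ x, Real.cos (k * x) ∂ρ := fun k => by
      rw [charFun_apply_real]
      have := integral_re (hi k)
      simp only [RCLike.re_eq_complex_re, e] at this
      exact this.symm
    have hic : Integrable (fun x => Real.cos (k * x)) ρ :=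
      Integrable.of_bound (by fun_prop) 1 (Filter.Eventually.of_forall fun x =>
        Real.abs_cos_le_one _)
    rw [integral_sub (integrable_const _) (hic.const_mul 2), integral_const_mul]
    simp only [hf, Complex.sub_re, Complex.add_re, hcos]
    simp
    ring
  have hb : ∀ k ∈ Icc (0 : ℝ) 1, ∫ x, (2 - 2 * Real.cos (k * x)) ∂ρ ≤ C * k ^ 2 := by
    intro k hk
    rw [hre k]
    have := hC k hk
    rw [taylorWithinEval_succ] at this
    simp only [taylor_within_zero_eval, iteratedDerivWithin_one, hdw, sub_zero, smul_zero,
      add_zero, zero_add, Nat.reduceAdd] at this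
    rw [norm_sub_rev] at this
    exact (Complex.re_le_norm _).trans this
  -- With `k = 1/(n + 1)`, this is `(2 - 2 cos(kx))/k²`. It tends to `x²` while its integrals stay
  -- bounded by `C`, so Fatou's lemma concludes.
  set F : ℕ → ℝ → ℝ := fun n x =>
    (2 - 2 * Real.cos ((1 / ((n : ℝ) + 1)) * x)) * ((n : ℝ) + 1) ^ 2 with hF
  have hFnn : ∀ n x, 0 ≤ F n x := fun n x =>
    mul_nonneg (by linarith [Real.cos_le_one ((1 / ((n : ℝ) + 1)) * x)]) (by positivity)
  have hFi : ∀ n, ∫⁻ x, ENNReal.ofReal (F n x) ∂ρ ≤ ENNReal.ofReal C := by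
    intro n
    have hFint : Integrable (F n) ρ :=
      Integrable.of_bound (by fun_prop) (4 * ((n : ℝ) + 1) ^ 2)
        (Filter.Eventually.of_forall fun x => by
          rw [Real.norm_of_nonneg (hFnn n x)]
          refine mul_le_mul_of_nonneg_right ?_ (by positivity)
          linarith [Real.neg_one_le_cos ((1 / ((n : ℝ) + 1)) * x)])
    rw [← ofReal_integral_eq_lintegral_ofReal hFint (Eventually.of_forall (hFnn n))]
    refine ENNReal.ofReal_le_ofReal ?_
    rw [hF, integral_mul_const]
    have h1 := hb (1 / ((n : ℝ) + 1)) ⟨by positivity, by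
      rw [div_le_one (by positivity)]; linarith [n.cast_nonneg (α := ℝ)]⟩
    calc _ ≤ C * (1 / ((n : ℝ) + 1)) ^ 2 * ((n : ℝ) + 1) ^ 2 :=
          mul_le_mul_of_nonneg_right h1 (by positivity)
      _ = C := by field_simp
  have hlim : ∀ x, Tendsto (fun n => F n x) atTop (𝓝 (x ^ 2)) := by
    intro x
    have hu : Tendsto (fun n : ℕ => 1 / ((n : ℝ) + 1)) atTop (𝓝 0) :=
      tendsto_one_div_add_atTop_nhds_zero_nat
    have hs : ∀ n, F n x = (x * Real.sinc ((1 / ((n : ℝ) + 1)) * x / 2)) ^ 2 := by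
      intro n
      rcases eq_or_ne x 0 with rfl | hx
      · simp [hF]
      · have hne : (1 / ((n : ℝ) + 1)) * x / 2 ≠ 0 := by positivity
        rw [Real.sinc_of_ne_zero hne]
        have : Real.cos ((1 / ((n : ℝ) + 1)) * x) =
            1 - 2 * Real.sin ((1 / ((n : ℝ) + 1)) * x / 2) ^ 2 := by
          rw [Real.sin_sq_eq_half_sub]
          ring_nf
        simp only [hF, this]
        field_simp
        ring
    simp_rw [hs]
    have hc : Continuous fun k : ℝ => (x * Real.sinc (k * x / 2)) ^ 2 := by
      have := Real.continuous_sinc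
      fun_prop
    have := (hc.tendsto 0).comp hu
    simpa [Function.comp_def] using this
  have hfat : ∫⁻ x, ENNReal.ofReal (x ^ 2) ∂ρ ≤ ENNReal.ofReal C := by
    calc ∫⁻ x, ENNReal.ofReal (x ^ 2) ∂ρ
        = ∫⁻ x, liminf (fun n => ENNReal.ofReal (F n x)) atTop ∂ρ := by
          refine lintegral_congr fun x => ?_
          exact ((ENNReal.continuous_ofReal.tendsto _).comp (hlim x)).liminf_eq.symm
      _ ≤ liminf (fun n => ∫⁻ x, ENNReal.ofReal (F n x) ∂ρ) atTop :=
          lintegral_liminf_le fun n => by fun_prop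
      _ ≤ ENNReal.ofReal C := by
          refine liminf_le_of_le (by isBoundedDefault) fun b hb => ?_
          obtain ⟨n, hn⟩ := hb.exists
          exact hn.trans (hFi n)
  refine ⟨by fun_prop, ?_⟩
  rw [hasFiniteIntegral_iff_ofReal (Eventually.of_forall fun x => sq_nonneg x)]
  exact hfat.trans_lt ENNReal.ofReal_lt_top

theorem memLp_id_two_mul {μ : Measure ℝ} [IsFiniteMeasure μ] {n : ℕ} (hn : 0 < n)
    (h : Integrable (fun x : ℝ => x ^ (2 * n)) μ) : MemLp id (2 * n : ℕ) μ := by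
  rw [← integrable_norm_rpow_iff (by fun_prop) (by positivity)
    (ENNReal.natCast_ne_top _)]
  refine h.congr (Eventually.of_forall fun x => ?_)
  simp only [id, ENNReal.toReal_natCast, Real.rpow_natCast, Real.norm_eq_abs]
  rw [pow_mul, pow_mul, sq_abs]

/-- A finite measure with smooth characteristic function has all even moments. -/
theorem integrable_pow_of_contDiff_charFun {μ : Measure ℝ} [IsFiniteMeasure μ]
    (h : ∀ n : ℕ, ContDiff ℝ n (charFun μ)) (n : ℕ) :
    Integrable (fun x : ℝ => x ^ (2 * n)) μ := by
  induction n with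
  | zero => simp
  | succ n ih =>
    have hmem : MemLp id (2 * n : ℕ) μ := by
      rcases Nat.eq_zero_or_pos n with rfl | hn
      · simpa using by fun_prop
      · exact memLp_id_two_mul hn ih
    -- Weighting by `x^(2n)` reduces the step to second moments: up to the factor `i^(2n)`, the
    -- characteristic function of `ρ` is the `2n`-th derivative of that of `μ`, hence still `C²`.
    set ρ := μ.withDensity fun x => ENNReal.ofReal (x ^ (2 * n)) with hρ
    have hnn : ∀ x : ℝ, 0 ≤ x ^ (2 * n) := fun x => by rw [pow_mul]; positivity
    have hρf : IsFiniteMeasure ρ := by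
      rw [← integrable_const_iff_isFiniteMeasure (one_ne_zero (α := ℝ)), hρ,
        integrable_withDensity_iff_integrable_smul' (by fun_prop) (by simp)]
      simpa [ENNReal.toReal_ofReal (hnn _)] using ih
    have hcf : charFun ρ = fun k => (Complex.I ^ (2 * n))⁻¹ * iteratedDeriv (2 * n) (charFun μ) k := by
      funext k
      rw [iteratedDeriv_charFun hmem, charFun_apply_real, hρ,
        integral_withDensity_eq_integral_toReal_smul (by fun_prop) (by simp),
        inv_mul_cancel_left₀ (pow_ne_zero _ Complex.I_ne_zero)]
      simp only [ENNReal.toReal_ofReal (hnn _), Complex.real_smul, Complex.ofReal_pow]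
    have hcd : ContDiff ℝ 2 (charFun ρ) := by
      rw [hcf]
      refine contDiff_const.mul ?_
      exact (h (2 + 2 * n)).iterate_deriv' 2 (2 * n) |> fun h' => by
        rw [iteratedDeriv_eq_iterate]; exact h'
    have := integrable_sq_of_contDiff_charFun hcd
    rw [hρ, integrable_withDensity_iff_integrable_smul' (by fun_prop) (by simp)] at this
    refine this.congr (Eventually.of_forall fun x => ?_)
    simp only [ENNReal.toReal_ofReal (hnn _), smul_eq_mul]
    ring

theorem weight_le_two_pow (m : ℕ) (x : ℝ) :
    (1 + x ^ 2) ^ m ≤ 2 ^ m * (1 + x ^ (2 * m)) := by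
  have h := add_pow_le (zero_le_one (α := ℝ)) (sq_nonneg x) m
  rw [one_pow, ← pow_mul] at h
  refine h.trans (mul_le_mul_of_nonneg_right ?_ ?_)
  · exact pow_le_pow_right₀ (by norm_num) (by omega)
  · have : 0 ≤ x ^ (2 * m) := by rw [pow_mul]; positivity
    linarith

theorem PolyMoments.of_contDiff_charFun {μ : Measure ℝ} [IsFiniteMeasure μ]
    (h : ∀ n : ℕ, ContDiff ℝ n (charFun μ)) : PolyMoments μ := fun m => by
  refine (((integrable_const 1).add (integrable_pow_of_contDiff_charFun h m)).const_mul
    (2 ^ m)).mono' (by fun_prop) (Eventually.of_forall fun x => ?_)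
  rw [Real.norm_of_nonneg (by positivity)]
  exact weight_le_two_pow m x

/-- The `2m`-th moment is the modulus of the `2m`-th derivative of the characteristic function at
`0`. Bounds on such derivatives that are uniform over a family therefore bound the moments
uniformly. -/
theorem integral_weight_le {μ : Measure ℝ} [IsProbabilityMeasure μ] (hμ : PolyMoments μ) (m : ℕ) :
    ∫ x, (1 + x ^ 2) ^ m ∂μ ≤ 2 ^ m * (1 + ‖iteratedDeriv (2 * m) (charFun μ) 0‖) := by
  have hnn : ∀ x : ℝ, 0 ≤ x ^ (2 * m) := fun x => by rw [pow_mul]; positivity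
  have hi : Integrable (fun x : ℝ => x ^ (2 * m)) μ := by
    refine (hμ m).mono' (by fun_prop) (Eventually.of_forall fun x => ?_)
    rw [Real.norm_of_nonneg (hnn x), pow_mul]
    exact pow_le_pow_left₀ (sq_nonneg x) (by linarith) m
  calc ∫ x, (1 + x ^ 2) ^ m ∂μ ≤ ∫ x, 2 ^ m * (1 + x ^ (2 * m)) ∂μ :=
        integral_mono (hμ m) (((integrable_const 1).add hi).const_mul _)
          fun x => weight_le_two_pow m x
    _ = 2 ^ m * (1 + ∫ x, x ^ (2 * m) ∂μ) := by
        rw [integral_const_mul, integral_add (integrable_const 1) hi]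
        simp
    _ = _ := by
        rw [iteratedDeriv_charFun_zero (hμ.memLp_id _), norm_mul, norm_pow, Complex.norm_I,
          one_pow, one_mul, Complex.norm_real, Real.norm_of_nonneg (integral_nonneg hnn)]

/-- Bounds on the derivatives of `ψ` at a point bound the derivatives of `exp ∘ ψ` there. -/
theorem exists_norm_iteratedDeriv_exp_le (M : ℕ → ℝ) (n : ℕ) :
    ∃ K : ℝ, ∀ ψ : ℝ → ℂ, (∀ j : ℕ, ContDiff ℝ j ψ) → ∀ x,
      (∀ i, ‖iteratedDeriv i ψ x‖ ≤ M i) →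
      ‖iteratedDeriv n (fun y => Complex.exp (ψ y)) x‖ ≤ K := by
  induction n using Nat.strong_induction_on with
  | _ n ih =>
    rcases n with _ | n
    · refine ⟨Real.exp (M 0), fun ψ _ x hM => ?_⟩
      rw [iteratedDeriv_zero, Complex.norm_exp]
      have := hM 0
      rw [iteratedDeriv_zero] at this
      exact Real.exp_le_exp.2 ((Complex.re_le_norm _).trans this)
    -- The identity `(exp ψ)' = exp ψ · ψ'` and the Leibniz rule express the derivative through
    -- lower ones. The bound involves only `M`, so it is uniform in `ψ`.
    · choose K hK using fun i : Fin (n + 1) => ih i i.2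
      refine ⟨∑ i : Fin (n + 1), (n.choose i : ℝ) * K i * M (n - i + 1), fun ψ hψ x hM => ?_⟩
      have hψd : ∀ y, HasDerivAt ψ (deriv ψ y) y := fun y =>
        ((hψ 1).differentiable (by norm_num) y).hasDerivAt
      have hd : deriv (fun y => Complex.exp (ψ y)) = fun y => Complex.exp (ψ y) * deriv ψ y :=
        funext fun y => (hψd y).cexp.deriv
      have hc1 : ContDiff ℝ n (fun y => Complex.exp (ψ y)) := (hψ n).cexp
      have hc2 : ContDiff ℝ n (deriv ψ) := by
        have := (hψ (n + 1)).iterate_deriv' n 1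
        simpa using this
      rw [iteratedDeriv_succ', hd, iteratedDeriv_fun_mul hc1.contDiffAt hc2.contDiffAt,
        Finset.sum_range fun i => (n.choose i : ℂ) *
          iteratedDeriv i (fun y => Complex.exp (ψ y)) x * iteratedDeriv (n - i) (deriv ψ) x]
      refine (norm_sum_le _ _).trans (Finset.sum_le_sum fun i _ => ?_)
      rw [norm_mul, norm_mul, Complex.norm_natCast, ← iteratedDeriv_succ']
      have h1 := hK i ψ hψ x hM
      have h2 := hM (n - i + 1)
      have h3 : 0 ≤ K i := (norm_nonneg _).trans h1
      gcongr

/-! ### Weakly continuous paths of laws and the forward equation. -/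

/-- Weakly continuous families of laws on the line, with moments of all orders that are bounded
uniformly over the family. -/
structure IsPolyPath (μ : ℝ → Measure ℝ) : Prop where
  isProbabilityMeasure : ∀ τ, IsProbabilityMeasure (μ τ)
  polyMoments : ∀ τ, PolyMoments (μ τ)
  bound : ∀ m : ℕ, ∃ C : ℝ, ∀ τ, ∫ x, (1 + x ^ 2) ^ m ∂(μ τ) ≤ C
  continuous_charFun : ∀ k : ℝ, Continuous fun τ => charFun (μ τ) k

namespace IsPolyPath

variable {μ : ℝ → Measure ℝ}

theorem exists_integral_le (h : IsPolyPath μ) {g : ℝ → ℝ} (hg : PolyBounded g) :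
    ∃ C : ℝ, 0 ≤ C ∧ ∀ τ, ∫ x, |g x| ∂(μ τ) ≤ C := by
  obtain ⟨C, m, hC, hb⟩ := hg.exists_nonneg_bound
  obtain ⟨D, hD⟩ := h.bound m
  have hD0 : 0 ≤ D := (integral_nonneg fun x => by positivity).trans (hD 0)
  refine ⟨C * D, by positivity, fun τ => ?_⟩
  calc ∫ x, |g x| ∂(μ τ) ≤ ∫ x, C * (1 + x ^ 2) ^ m ∂(μ τ) :=
        integral_mono (hg.integrable (h.polyMoments τ)).abs ((h.polyMoments τ m).const_mul C) hb
    _ = C * ∫ x, (1 + x ^ 2) ^ m ∂(μ τ) := integral_const_mul _ _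
    _ ≤ C * D := mul_le_mul_of_nonneg_left (hD τ) hC

/-- The members of the family as bundled probability measures. -/
def probabilityMeasure (h : IsPolyPath μ) (τ : ℝ) : ProbabilityMeasure ℝ :=
  ⟨μ τ, h.isProbabilityMeasure τ⟩

theorem continuous_probabilityMeasure (h : IsPolyPath μ) : Continuous h.probabilityMeasure := by
  rw [continuous_iff_seqContinuous]
  intro u τ hu
  refine ProbabilityMeasure.tendsto_of_tendsto_charFun fun k => ?_
  exact ((h.continuous_charFun k).tendsto τ).comp hu

/-- Closed sets form a generating π-system, and their indicators are limits of bounded continuous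
functions, whose integrals are continuous in `τ`. This is what allows the path to serve as a kernel.
-/
theorem measurable (h : IsPolyPath μ) : Measurable μ := by
  have := h.isProbabilityMeasure
  refine Measurable.measure_of_isPiSystem_of_isProbabilityMeasure
    (BorelSpace.measurable_eq.trans borel_eq_generateFrom_isClosed) isPiSystem_isClosed
    fun F hF => ?_
  refine measurable_of_tendsto_metrizable
    (f := fun (n : ℕ) τ => ∫⁻ x, hF.apprSeq n x ∂(μ τ)) (fun n => ?_) ?_
  · refine Continuous.measurable ?_
    rw [continuous_iff_continuousAt]
    intro τ
    exact ProbabilityMeasure.tendsto_iff_forall_lintegral_tendsto.1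
      (h.continuous_probabilityMeasure.tendsto τ) (hF.apprSeq n)
  · rw [tendsto_pi_nhds]
    exact fun τ => HasOuterApproxClosed.tendsto_lintegral_apprSeq hF (μ τ)

theorem continuous_integral_boundedContinuous (h : IsPolyPath μ) (f : ℝ →ᵇ ℝ) :
    Continuous fun τ => ∫ x, f x ∂(μ τ) := by
  rw [continuous_iff_continuousAt]
  intro τ
  exact ProbabilityMeasure.tendsto_iff_forall_integral_tendsto.1
    (h.continuous_probabilityMeasure.tendsto τ) f

theorem abs_sub_clamp_le {K : ℝ} (hK : 0 < K) (y : ℝ) :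
    |y - max (-K) (min K y)| ≤ y ^ 2 / K := by
  rw [le_div_iff₀ hK]
  rcases le_total K y with h1 | h1
  · rw [min_eq_left h1, max_eq_right (by linarith), abs_of_nonneg (by linarith)]
    nlinarith
  · rw [min_eq_right h1]
    rcases le_total (-K) y with h2 | h2
    · rw [max_eq_right h2]; simp; positivity
    · rw [max_eq_left h2, abs_of_nonpos (by linarith)]
      nlinarith

/-- Truncating `g` at height `K` costs at most `∫ g² dμ_τ / K`, uniformly in `τ`. The integral is
thus a uniform limit of integrals of bounded continuous functions. -/
theorem continuous_integral (h : IsPolyPath μ) {g : ℝ → ℝ} (hg : PolyBounded g) :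
    Continuous fun τ => ∫ x, g x ∂(μ τ) := by
  have := h.isProbabilityMeasure
  obtain ⟨C, hC, hb⟩ := h.exists_integral_le hg.sq
  refine continuous_of_uniform_approx_of_continuous fun u hu => ?_
  obtain ⟨ε, hε, hεu⟩ := Metric.mem_uniformity_dist.1 hu
  -- Chosen so that `C / K < ε`; the `+ 1` keeps `K` positive when `C = 0`.
  set K := (C + 1) / ε with hK
  have hKpos : 0 < K := by positivity
  have hcl : ∀ y : ℝ, |max (-K) (min K y)| ≤ K := fun y =>
    abs_le.2 ⟨le_max_left _ _, max_le (by linarith) (min_le_left _ _)⟩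
  let f : ℝ →ᵇ ℝ := BoundedContinuousFunction.ofNormedAddCommGroup
    (fun x => max (-K) (min K (g x)))
    (continuous_const.max (continuous_const.min hg.continuous)) K fun x => hcl _
  refine ⟨_, h.continuous_integral_boundedContinuous f, fun τ => hεu ?_⟩
  have hgi := hg.integrable (h.polyMoments τ)
  have hfi : Integrable f (μ τ) := f.integrable _
  rw [Real.dist_eq, ← integral_sub hgi hfi]
  calc |∫ x, (g x - f x) ∂(μ τ)| ≤ ∫ x, |g x - f x| ∂(μ τ) := abs_integral_le_integral_abs
    _ ≤ ∫ x, |g x ^ 2| / K ∂(μ τ) :=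
        integral_mono (hgi.sub hfi).abs ((hg.sq.integrable (h.polyMoments τ)).abs.div_const K)
          fun x => by
            rw [abs_of_nonneg (sq_nonneg (g x))]
            exact abs_sub_clamp_le hKpos (g x)
    _ = (∫ x, |g x ^ 2| ∂(μ τ)) / K := integral_div _ _
    _ ≤ C / K := div_le_div_of_nonneg_right (hb τ) hKpos.le
    _ < ε := by
        rw [hK, div_div_eq_mul_div, div_lt_iff₀ (by positivity)]
        nlinarith

/-- The family as a transition kernel. -/
noncomputable def kernel (h : IsPolyPath μ) : Kernel ℝ ℝ := ⟨μ, h.measurable⟩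

instance (h : IsPolyPath μ) : IsMarkovKernel h.kernel := ⟨h.isProbabilityMeasure⟩

theorem integral_comp_measure {E : Type*} [NormedAddCommGroup E] [NormedSpace ℝ E]
    {κ : Kernel ℝ ℝ} {ν : Measure ℝ} {f : ℝ → E} (hf : Integrable f (κ ∘ₘ ν)) :
    ∫ x, f x ∂(κ ∘ₘ ν) = ∫ τ, ∫ x, f x ∂(κ τ) ∂ν := by
  rw [Measure.comp_eq_comp_const_apply] at hf ⊢
  rw [Kernel.integral_comp hf, Kernel.const_apply]

/-- The occupation measure of the family over `(s, r]`, convolved with `B`. -/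
noncomputable def occupation (h : IsPolyPath μ) (B : Measure ℝ) (s r : ℝ) : Measure ℝ :=
  (h.kernel ∘ₘ (volume.restrict (Ioc s r))) ∗ B

theorem polyMoments_comp (h : IsPolyPath μ) (s r : ℝ) :
    PolyMoments (h.kernel ∘ₘ (volume.restrict (Ioc s r))) := fun m => by
  rw [Measure.integrable_comp_iff (by fun_prop)]
  refine ⟨Eventually.of_forall fun τ => h.polyMoments τ m, ?_⟩
  have e : ∀ x : ℝ, ‖(1 + x ^ 2) ^ m‖ = (1 + x ^ 2) ^ m := fun x =>
    Real.norm_of_nonneg (by positivity)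
  simp only [e]
  exact (h.continuous_integral (polyBounded_weight m)).integrableOn_Ioc

theorem polyMoments_occupation (h : IsPolyPath μ) {B : Measure ℝ} (hB : PolyMoments B) (s r : ℝ) :
    PolyMoments (h.occupation B s r) := by
  have := hB.isFiniteMeasure
  exact (h.polyMoments_comp s r).conv hB

theorem integral_occupation (h : IsPolyPath μ) {B : Measure ℝ} (hB : PolyMoments B) {s r : ℝ}
    (hsr : s ≤ r) {g : ℝ → ℝ} (hg : PolyBounded g) :
    ∫ x, g x ∂(h.occupation B s r) = ∫ τ in s..r, ∫ x, ∫ v, g (x + v) ∂B ∂(μ τ) := by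
  have := hB.isFiniteMeasure
  rw [occupation, integral_conv (hg.integrable ((h.polyMoments_comp s r).conv hB)),
    integral_comp_measure ((hg.integral_add hB).integrable (h.polyMoments_comp s r)),
    intervalIntegral.integral_of_le hsr]
  rfl

theorem charFun_occupation (h : IsPolyPath μ) {B : Measure ℝ} (hB : PolyMoments B) {s r : ℝ}
    (hsr : s ≤ r) (k : ℝ) :
    charFun (h.occupation B s r) k = (∫ τ in s..r, charFun (μ τ) k) * charFun B k := by
  have := hB.isFiniteMeasure
  rw [occupation, charFun_conv, charFun_apply_real, integral_comp_measure,
    intervalIntegral.integral_of_le hsr]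
  · congr 1
    refine integral_congr_ae (Eventually.of_forall fun τ => ?_)
    simp only [charFun_apply_real]
    rfl
  · refine Integrable.of_bound (by fun_prop) 1 (Eventually.of_forall fun x => ?_)
    rw [← Complex.ofReal_mul, Complex.norm_exp_ofReal_mul_I]

/-- The integrated forward equation. -/
theorem integral_sub_integral (h : IsPolyPath μ) {B₁ B₂ : Measure ℝ} (hB₁ : PolyMoments B₁)
    (hB₂ : PolyMoments B₂) {s r : ℝ} (hsr : s ≤ r)
    (hc : ∀ k : ℝ, charFun (μ r) k - charFun (μ s) k =
      -(k : ℂ) ^ 2 * ((∫ τ in s..r, charFun (μ τ) k) * (charFun B₁ k - charFun B₂ k)))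
    {g g' g'' : ℝ → ℝ} (hd1 : ∀ x, HasDerivAt g (g' x) x)
    (hd2 : ∀ x, HasDerivAt g' (g'' x) x) (hg : PolyBounded g) (hg'' : PolyBounded g'') :
    ∫ x, g x ∂(μ r) - ∫ x, g x ∂(μ s) =
      ∫ τ in s..r, ∫ x, (∫ v, g'' (x + v) ∂B₁ - ∫ v, g'' (x + v) ∂B₂) ∂(μ τ) := by
  have := h.isProbabilityMeasure
  -- The measures `N₁`, `N₂` are the occupation measures over `(s, r]` convolved with `B₁` and `B₂`.
  rw [integral_sub_eq_of_charFun (h.polyMoments r) (h.polyMoments s)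
    (h.polyMoments_occupation hB₁ s r) (h.polyMoments_occupation hB₂ s r) ?_ hd1 hd2 hg hg'',
    h.integral_occupation hB₁ hsr hg'', h.integral_occupation hB₂ hsr hg'',
    ← intervalIntegral.integral_sub
      ((h.continuous_integral (hg''.integral_add hB₁)).intervalIntegrable _ _)
      ((h.continuous_integral (hg''.integral_add hB₂)).intervalIntegrable _ _)]
  · refine intervalIntegral.integral_congr fun τ _ => ?_
    exact (integral_sub ((hg''.integral_add hB₁).integrable (h.polyMoments τ))
      ((hg''.integral_add hB₂).integrable (h.polyMoments τ))).symm
  · intro k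
    rw [hc k, h.charFun_occupation hB₁ hsr, h.charFun_occupation hB₂ hsr]
    ring

/-- The fundamental theorem of calculus for the integrated equation; the integrand is continuous in
time because averaging `g''` keeps polynomial growth. -/
theorem hasDerivWithinAt_integral (h : IsPolyPath μ) {B₁ B₂ : Measure ℝ} (hB₁ : PolyMoments B₁)
    (hB₂ : PolyMoments B₂) {s b : ℝ} (hsb : s < b)
    (hc : ∀ k r : ℝ, s ≤ r → r ≤ b → charFun (μ r) k - charFun (μ s) k =
      -(k : ℂ) ^ 2 * ((∫ τ in s..r, charFun (μ τ) k) * (charFun B₁ k - charFun B₂ k)))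
    {g g' g'' : ℝ → ℝ} (hd1 : ∀ x, HasDerivAt g (g' x) x)
    (hd2 : ∀ x, HasDerivAt g' (g'' x) x) (hg : PolyBounded g) (hg'' : PolyBounded g'') :
    HasDerivWithinAt (fun r => ∫ x, g x ∂(μ r))
      (∫ x, (∫ v, g'' (x + v) ∂B₁ - ∫ v, g'' (x + v) ∂B₂) ∂(μ s)) (Ici s) s := by
  have hcont := h.continuous_integral ((hg''.integral_add hB₁).sub (hg''.integral_add hB₂))
  have hF : HasDerivWithinAt (fun r => (∫ x, g x ∂(μ s)) +
      ∫ τ in s..r, ∫ x, (∫ v, g'' (x + v) ∂B₁ - ∫ v, g'' (x + v) ∂B₂) ∂(μ τ))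
      (∫ x, (∫ v, g'' (x + v) ∂B₁ - ∫ v, g'' (x + v) ∂B₂) ∂(μ s)) (Ici s) s :=
    ((intervalIntegral.integral_hasDerivAt_right (hcont.intervalIntegrable _ _)
      hcont.aestronglyMeasurable.stronglyMeasurableAtFilter hcont.continuousAt).const_add
        _).hasDerivWithinAt
  refine hF.congr_of_eventuallyEq ?_ (by simp)
  filter_upwards [Icc_mem_nhdsGE hsb] with r hr
  rw [← h.integral_sub_integral hB₁ hB₂ hr.1 (fun k => hc k r hr.1 hr.2) hd1 hd2 hg hg'']
  ring

end IsPolyPath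

/-! ### The path of laws with affine exponent. -/

/-- The exponent `k ↦ -k² (Â(k) + τ (B̂₁(k) - B̂₂(k)))`. -/
noncomputable def pathExponent (A B₁ B₂ : Measure ℝ) (τ k : ℝ) : ℂ :=
  -(k : ℂ) ^ 2 * (charFun A k + τ * (charFun B₁ k - charFun B₂ k))

section

variable {A B₁ B₂ : Measure ℝ}

theorem PolyMoments.contDiff_charFun {μ : Measure ℝ} (hμ : PolyMoments μ) (n : ℕ) :
    ContDiff ℝ n (charFun μ) := by
  have := hμ.isFiniteMeasure
  exact MeasureTheory.contDiff_charFun (hμ.memLp_id n)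

theorem contDiff_neg_sq_mul {f : ℝ → ℂ} {n : ℕ} (hf : ContDiff ℝ n f) :
    ContDiff ℝ n fun k : ℝ => -(k : ℂ) ^ 2 * f k :=
  ((Complex.ofRealCLM.contDiff.pow 2).neg).mul hf

theorem pathExponent_eq (τ : ℝ) : pathExponent A B₁ B₂ τ =
    (fun k : ℝ => -(k : ℂ) ^ 2 * charFun A k) +
      τ • fun k : ℝ => -(k : ℂ) ^ 2 * (charFun B₁ k - charFun B₂ k) := by
  funext k
  simp only [pathExponent, Pi.add_apply, Pi.smul_apply, Complex.real_smul]
  ring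

theorem contDiff_pathExponent (hA : PolyMoments A) (hB₁ : PolyMoments B₁) (hB₂ : PolyMoments B₂)
    (τ : ℝ) (n : ℕ) : ContDiff ℝ n (pathExponent A B₁ B₂ τ) := by
  rw [pathExponent_eq]
  exact (contDiff_neg_sq_mul (hA.contDiff_charFun n)).add
    ((contDiff_neg_sq_mul ((hB₁.contDiff_charFun n).sub (hB₂.contDiff_charFun n))).const_smul τ)

/-- The exponent is affine in `τ`, so its derivatives at `0` are bounded uniformly on `[0, b]`. -/
theorem exists_norm_iteratedDeriv_pathExponent_le (hA : PolyMoments A) (hB₁ : PolyMoments B₁)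
    (hB₂ : PolyMoments B₂) (b : ℝ) : ∃ M : ℕ → ℝ, ∀ τ ∈ Icc 0 b, ∀ i,
      ‖iteratedDeriv i (pathExponent A B₁ B₂ τ) 0‖ ≤ M i := by
  refine ⟨fun i => ‖iteratedDeriv i (fun k : ℝ => -(k : ℂ) ^ 2 * charFun A k) 0‖ +
    b * ‖iteratedDeriv i (fun k : ℝ => -(k : ℂ) ^ 2 * (charFun B₁ k - charFun B₂ k)) 0‖,
    fun τ hτ i => ?_⟩
  have h1 := contDiff_neg_sq_mul (hA.contDiff_charFun i)
  have h2 := contDiff_neg_sq_mul ((hB₁.contDiff_charFun i).sub (hB₂.contDiff_charFun i))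
  have h3 : ContDiff ℝ i (τ • fun k : ℝ => -(k : ℂ) ^ 2 * (charFun B₁ k - charFun B₂ k)) :=
    h2.const_smul τ
  rw [pathExponent_eq, iteratedDeriv_add h1.contDiffAt h3.contDiffAt,
    iteratedDeriv_const_smul h2.contDiffAt τ]
  refine (norm_add_le _ _).trans ?_
  rw [norm_smul, Real.norm_of_nonneg hτ.1]
  exact add_le_add_right (mul_le_mul_of_nonneg_right hτ.2 (norm_nonneg _)) _

theorem integral_weight_conv_le {μ ν : Measure ℝ} [SFinite μ] [SFinite ν] (hμ : PolyMoments μ)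
    (hν : PolyMoments ν) (m : ℕ) : ∫ x, (1 + x ^ 2) ^ m ∂(μ ∗ ν) ≤
      2 ^ m * ((∫ x, (1 + x ^ 2) ^ m ∂μ) * ∫ x, (1 + x ^ 2) ^ m ∂ν) := by
  have hm : Measurable fun p : ℝ × ℝ => p.1 + p.2 := by fun_prop
  rw [Measure.conv, integral_map hm.aemeasurable (by fun_prop), ← integral_prod_mul,
    ← integral_const_mul]
  exact integral_mono ((polyBounded_weight m).integrable_prod_add hμ hν)
    (((hμ m).mul_prod (hν m)).const_mul _) fun p => weight_add_le m p.1 p.2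

theorem integral_exp_add_mul (a d : ℂ) (s r : ℝ) :
    Complex.exp (a + r * d) - Complex.exp (a + s * d) =
      d * ∫ τ in s..r, Complex.exp (a + τ * d) := by
  have hd : ∀ τ ∈ uIcc s r, HasDerivAt (fun τ : ℝ => Complex.exp (a + τ * d))
      (d * Complex.exp (a + τ * d)) τ := fun τ _ => by
    have h1 : HasDerivAt (fun τ : ℝ => a + (τ : ℂ) * d) d τ := by
      simpa using ((hasDerivAt_id τ).ofReal_comp.mul_const d).const_add a
    exact h1.cexp.congr_deriv (mul_comm _ _)
  rw [← intervalIntegral.integral_const_mul, intervalIntegral.integral_eq_sub_of_hasDerivAt hd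
    (by apply Continuous.intervalIntegrable; fun_prop)]

/-- The time `τ`, moved into `[0, b]`. -/
noncomputable def clampTime (b τ : ℝ) : ℝ := max 0 (min τ b)

theorem clampTime_mem {b : ℝ} (hb : 0 ≤ b) (τ : ℝ) : clampTime b τ ∈ Icc 0 b :=
  ⟨le_max_left _ _, max_le hb (min_le_right _ _)⟩

theorem clampTime_of_mem {b τ : ℝ} (h : τ ∈ Icc 0 b) : clampTime b τ = τ := by
  rw [clampTime, min_eq_left h.2, max_eq_right h.1]

theorem continuous_clampTime (b : ℝ) : Continuous (clampTime b) := by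
  unfold clampTime; fun_prop

variable {b : ℝ} {η : Measure ℝ} [IsProbabilityMeasure η] {ζ : ℝ → Measure ℝ}

theorem polyMoments_of_charFun_eq_exp (hA : PolyMoments A) (hB₁ : PolyMoments B₁)
    (hB₂ : PolyMoments B₂) {τ : ℝ} {ζ : Measure ℝ} [IsFiniteMeasure ζ]
    (hc : ∀ k, charFun ζ k = Complex.exp (pathExponent A B₁ B₂ τ k)) : PolyMoments ζ :=
  PolyMoments.of_contDiff_charFun fun n => by
    rw [funext hc]
    exact (contDiff_pathExponent hA hB₁ hB₂ τ n).cexp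

/-- Clamping time to `[0, b]` extends the family to all real times, with moment bounds that remain
uniform because the interval is compact. -/
theorem isPolyPath_conv (hb : 0 ≤ b) (hη : PolyMoments η) (hA : PolyMoments A)
    (hB₁ : PolyMoments B₁) (hB₂ : PolyMoments B₂)
    (hζ : ∀ τ ∈ Icc 0 b, IsProbabilityMeasure (ζ τ))
    (hc : ∀ τ ∈ Icc 0 b, ∀ k, charFun (ζ τ) k = Complex.exp (pathExponent A B₁ B₂ τ k)) :
    IsPolyPath fun τ => η ∗ ζ (clampTime b τ) := by
  have hprob : ∀ τ, IsProbabilityMeasure (ζ (clampTime b τ)) := fun τ => hζ _ (clampTime_mem hb τ)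
  have hpm : ∀ τ, PolyMoments (ζ (clampTime b τ)) := fun τ =>
    polyMoments_of_charFun_eq_exp hA hB₁ hB₂ (hc _ (clampTime_mem hb τ))
  refine ⟨fun τ => inferInstance, fun τ => hη.conv (hpm τ), fun m => ?_, fun k => ?_⟩
  · obtain ⟨M, hM⟩ := exists_norm_iteratedDeriv_pathExponent_le hA hB₁ hB₂ b
    obtain ⟨K, hK⟩ := exists_norm_iteratedDeriv_exp_le M (2 * m)
    refine ⟨2 ^ m * ((∫ x, (1 + x ^ 2) ^ m ∂η) * (2 ^ m * (1 + K))), fun τ => ?_⟩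
    refine (integral_weight_conv_le hη (hpm τ) m).trans ?_
    have h1 : 0 ≤ ∫ x, (1 + x ^ 2) ^ m ∂η := integral_nonneg fun x => by positivity
    have h2 := integral_weight_le (hpm τ) m
    have h3 := hK (pathExponent A B₁ B₂ (clampTime b τ))
      (fun j => contDiff_pathExponent hA hB₁ hB₂ _ j) 0 (hM _ (clampTime_mem hb τ))
    rw [← funext (hc _ (clampTime_mem hb τ))] at h3
    gcongr
    exact h2.trans (by gcongr)
  · simp only [charFun_conv, fun τ => hc _ (clampTime_mem hb τ), pathExponent]
    have := continuous_clampTime b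
    fun_prop

/-- The characteristic function solves a linear equation in `τ` with rate `-k²(B̂₁ - B̂₂)`; this is
its integrated form. -/
theorem charFun_conv_sub (hζ : ∀ τ ∈ Icc 0 b, IsProbabilityMeasure (ζ τ))
    (hc : ∀ τ ∈ Icc 0 b, ∀ k, charFun (ζ τ) k = Complex.exp (pathExponent A B₁ B₂ τ k))
    {s r : ℝ} (hs : 0 ≤ s) (hsr : s ≤ r) (hr : r ≤ b) (k : ℝ) :
    charFun (η ∗ ζ (clampTime b r)) k - charFun (η ∗ ζ (clampTime b s)) k =
      -(k : ℂ) ^ 2 * ((∫ τ in s..r, charFun (η ∗ ζ (clampTime b τ)) k) *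
        (charFun B₁ k - charFun B₂ k)) := by
  have hb : 0 ≤ b := hs.trans (hsr.trans hr)
  have e : ∀ τ ∈ Icc s r, charFun (η ∗ ζ (clampTime b τ)) k = charFun η k *
      Complex.exp (-(k : ℂ) ^ 2 * charFun A k +
        τ * (-(k : ℂ) ^ 2 * (charFun B₁ k - charFun B₂ k))) := fun τ hτ => by
    have := hζ _ (clampTime_mem hb τ)
    rw [charFun_conv, hc _ (clampTime_mem hb τ), pathExponent,
      clampTime_of_mem ⟨hs.trans hτ.1, hτ.2.trans hr⟩]
    ring_nf
  rw [e r (right_mem_Icc.2 hsr), e s (left_mem_Icc.2 hsr), ← mul_sub, integral_exp_add_mul,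
    intervalIntegral.integral_congr (fun τ hτ => e τ (by rwa [uIcc_of_le hsr] at hτ)),
    intervalIntegral.integral_const_mul]
  ring

end

/-! ### Single and double triangular averages. -/

theorem integrable_average_of_taylorMix {E : Type*} [NormedAddCommGroup E] [NormedSpace ℝ E]
    {μ : Measure ℝ} [IsFiniteMeasure μ] {g : ℝ → E} (hg : Integrable g (taylorMix μ)) :
    Integrable (fun u => ∫ s in (0 : ℝ)..1, (1 - s) • g (s * u)) μ := by
  have hm : Measurable fun p : ℝ × ℝ => p.2 * p.1 := by fun_prop
  simp_rw [← fun u : ℝ => integral_triangleMeasure fun s => g (s * u)]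
  exact ((integrable_map_measure hg.1 hm.aemeasurable).1 hg).integral_prod_left

theorem triangleMeasure_prod : triangleMeasure.prod triangleMeasure =
    (volume.restrict (Ioo (0 : ℝ) 1 ×ˢ Ioo (0 : ℝ) 1)).withDensity
      fun s => ENNReal.ofReal (1 - s.1) * ENNReal.ofReal (1 - s.2) := by
  rw [triangleMeasure, prod_withDensity (by fun_prop) (by fun_prop),
    ← Measure.restrict_congr_set (Ioo_ae_eq_Ioc (μ := (volume : Measure ℝ))), Measure.prod_restrict]
  rfl

theorem integral_triangleMeasure_prod (f : ℝ × ℝ → ℝ) :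
    ∫ s, f s ∂(triangleMeasure.prod triangleMeasure) =
      ∫ s in Ioo (0 : ℝ) 1 ×ˢ Ioo (0 : ℝ) 1, (1 - s.1) * (1 - s.2) * f s := by
  rw [triangleMeasure_prod, integral_withDensity_eq_integral_toReal_smul (by fun_prop)
    (Eventually.of_forall fun s => ENNReal.mul_lt_top ENNReal.ofReal_lt_top ENNReal.ofReal_lt_top)]
  refine setIntegral_congr_fun (measurableSet_Ioo.prod measurableSet_Ioo) fun s hs => ?_
  rw [ENNReal.toReal_mul, ENNReal.toReal_ofReal (by linarith [hs.1.2]),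
    ENNReal.toReal_ofReal (by linarith [hs.2.2]), smul_eq_mul]

/-- It suffices to compare on rectangles, where Tonelli factorises the integral into the pairs `(u₁,
s₁)` and `(u₂, s₂)`. -/
theorem map_prod_eq_taylorMix_prod {a b : Measure ℝ} [IsFiniteMeasure a] [IsFiniteMeasure b] :
    (((a.prod b).prod (triangleMeasure.prod triangleMeasure)).map
      fun p : (ℝ × ℝ) × (ℝ × ℝ) => (p.2.1 * p.1.1, p.2.2 * p.1.2)) =
      (taylorMix a).prod (taylorMix b) := by
  symm
  refine Measure.prod_eq fun S T hS hT => ?_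
  have hm : Measurable fun p : ℝ × ℝ => p.2 * p.1 := by fun_prop
  have key : ∀ (c : Measure ℝ) [IsFiniteMeasure c] (U : Set ℝ), MeasurableSet U →
      taylorMix c U = ∫⁻ u, ∫⁻ s, U.indicator (fun _ => 1) (s * u) ∂triangleMeasure ∂c := by
    intro c _ U hU
    rw [← lintegral_indicator_one hU, taylorMix,
      lintegral_map (measurable_one.indicator hU) hm,
      lintegral_prod (fun p : ℝ × ℝ => U.indicator 1 (p.2 * p.1))
        (((measurable_one.indicator hU).comp hm).aemeasurable)]
    rfl
  have hi : ∀ U : Set ℝ, MeasurableSet U →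
      Measurable fun p : ℝ × ℝ => U.indicator (fun _ => (1 : ENNReal)) (p.2 * p.1) :=
    fun U hU => (measurable_const.indicator hU).comp hm
  rw [Measure.map_apply (by fun_prop) (hS.prod hT),
    ← lintegral_indicator_one ((by fun_prop : Measurable fun p : (ℝ × ℝ) × (ℝ × ℝ) =>
      (p.2.1 * p.1.1, p.2.2 * p.1.2)) (hS.prod hT))]
  have e : ∀ p : (ℝ × ℝ) × (ℝ × ℝ), ((fun p : (ℝ × ℝ) × (ℝ × ℝ) =>
      (p.2.1 * p.1.1, p.2.2 * p.1.2)) ⁻¹' (S ×ˢ T)).indicator (1 : (ℝ × ℝ) × (ℝ × ℝ) → ENNReal) p =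
      S.indicator (fun _ => 1) (p.2.1 * p.1.1) * T.indicator (fun _ => 1) (p.2.2 * p.1.2) := by
    intro p
    by_cases h1 : p.2.1 * p.1.1 ∈ S <;> by_cases h2 : p.2.2 * p.1.2 ∈ T <;>
      simp [indicator, h1, h2]
  have h1 : Measurable fun p : (ℝ × ℝ) × (ℝ × ℝ) =>
      S.indicator (fun _ => (1 : ENNReal)) (p.2.1 * p.1.1) :=
    (hi S hS).comp (by fun_prop : Measurable fun p : (ℝ × ℝ) × (ℝ × ℝ) => (p.1.1, p.2.1))
  have h2 : Measurable fun p : (ℝ × ℝ) × (ℝ × ℝ) =>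
      T.indicator (fun _ => (1 : ENNReal)) (p.2.2 * p.1.2) :=
    (hi T hT).comp (by fun_prop : Measurable fun p : (ℝ × ℝ) × (ℝ × ℝ) => (p.1.2, p.2.2))
  simp_rw [e]
  rw [lintegral_prod (fun p : (ℝ × ℝ) × (ℝ × ℝ) => S.indicator (fun _ => (1 : ENNReal))
      (p.2.1 * p.1.1) * T.indicator (fun _ => 1) (p.2.2 * p.1.2)) (h1.mul h2).aemeasurable, key a S hS, key b T hT,
    ← lintegral_prod_mul (hi S hS).lintegral_prod_right'.aemeasurable
      (hi T hT).lintegral_prod_right'.aemeasurable]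
  refine lintegral_congr fun u => ?_
  exact lintegral_prod_mul
    ((hi S hS).comp (by fun_prop : Measurable fun s : ℝ => (u.1, s))).aemeasurable
    ((hi T hT).comp (by fun_prop : Measurable fun s : ℝ => (u.2, s))).aemeasurable

section Double

variable {a b : Measure ℝ} {K : ℝ → ℝ}

theorem PolyBounded.integrable_prod_triangle (hK : PolyBounded K) (ha : PolyMoments a)
    (hb : PolyMoments b) : Integrable (fun p : (ℝ × ℝ) × (ℝ × ℝ) =>
      K (p.2.1 * p.1.1 + p.2.2 * p.1.2))
      ((a.prod b).prod (triangleMeasure.prod triangleMeasure)) := by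
  have := ha.isFiniteMeasure
  have := hb.isFiniteMeasure
  have hc : Continuous fun p : ℝ × ℝ => K (p.1 + p.2) := hK.continuous.comp (by fun_prop)
  have h := hK.integrable_prod_add ha.taylorMix hb.taylorMix
  rw [← map_prod_eq_taylorMix_prod, integrable_map_measure
    hc.aestronglyMeasurable (by fun_prop)] at h
  exact h

theorem PolyBounded.integrable_double_average (hK : PolyBounded K) (ha : PolyMoments a)
    (hb : PolyMoments b) : Integrable (fun u : ℝ × ℝ =>
      ∫ s in Ioo (0 : ℝ) 1 ×ˢ Ioo (0 : ℝ) 1, (1 - s.1) * (1 - s.2) *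
        K (s.1 * u.1 + s.2 * u.2)) (a.prod b) := by
  have := ha.isFiniteMeasure
  have := hb.isFiniteMeasure
  simp_rw [← integral_triangleMeasure_prod]
  exact (hK.integrable_prod_triangle ha hb).integral_prod_left

theorem PolyBounded.integral_double_average (hK : PolyBounded K) (ha : PolyMoments a)
    (hb : PolyMoments b) : ∫ u : ℝ × ℝ, (∫ s in Ioo (0 : ℝ) 1 ×ˢ Ioo (0 : ℝ) 1,
      (1 - s.1) * (1 - s.2) * K (s.1 * u.1 + s.2 * u.2)) ∂(a.prod b) =
      ∫ v, ∫ w, K (v + w) ∂(taylorMix b) ∂(taylorMix a) := by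
  have := ha.isFiniteMeasure
  have := hb.isFiniteMeasure
  have hc : Continuous fun p : ℝ × ℝ => K (p.1 + p.2) := hK.continuous.comp (by fun_prop)
  simp_rw [← fun u : ℝ × ℝ => integral_triangleMeasure_prod
    fun s => K (s.1 * u.1 + s.2 * u.2)]
  rw [← integral_prod _ (hK.integrable_prod_triangle ha hb),
    ← integral_prod _ (hK.integrable_prod_add ha.taylorMix hb.taylorMix),
    ← map_prod_eq_taylorMix_prod, integral_map (by fun_prop)
      hc.aestronglyMeasurable]

end Double

/-! ### Integration against a signed measure through its Jordan decomposition. -/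

namespace MeasureTheory.SignedMeasure

variable (Δ : SignedMeasure ℝ)

theorem eq_posPart_sub_negPart : Δ = Δ.toJordanDecomposition.posPart.toSignedMeasure -
    Δ.toJordanDecomposition.negPart.toSignedMeasure :=
  Δ.toSignedMeasure_toJordanDecomposition.symm

variable {Δ}

theorem integral_eq_sub {E : Type*} [NormedAddCommGroup E] [NormedSpace ℝ E] {f : ℝ → E}
    (h1 : Integrable f Δ.toJordanDecomposition.posPart)
    (h2 : Integrable f Δ.toJordanDecomposition.negPart) :
    ∫ᵛ u, f u ∂<•Δ = ∫ u, f u ∂Δ.toJordanDecomposition.posPart -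
      ∫ u, f u ∂Δ.toJordanDecomposition.negPart := by
  conv_lhs => rw [Δ.eq_posPart_sub_negPart]
  rw [VectorMeasure.integral_sub_vectorMeasure, VectorMeasure.integral_toSignedMeasure,
    VectorMeasure.integral_toSignedMeasure]
  · simpa [VectorMeasure.Integrable] using h1
  · simpa [VectorMeasure.Integrable] using h2

/-- Both sides agree on rectangles by expanding the product of two differences; grouping the terms
by sign leaves only positive measures. -/
theorem prod_mul_eq : Δ.prod Δ (ContinuousLinearMap.mul ℝ ℝ) =
    ((Δ.toJordanDecomposition.posPart.prod Δ.toJordanDecomposition.posPart).toSignedMeasure +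
      (Δ.toJordanDecomposition.negPart.prod Δ.toJordanDecomposition.negPart).toSignedMeasure) -
    ((Δ.toJordanDecomposition.posPart.prod Δ.toJordanDecomposition.negPart).toSignedMeasure +
      (Δ.toJordanDecomposition.negPart.prod Δ.toJordanDecomposition.posPart).toSignedMeasure) := by
  refine VectorMeasure.prod_eq_of_forall_apply_prod fun S T hS hT => ?_
  have h : ∀ U : Set ℝ, MeasurableSet U → Δ U = Δ.toJordanDecomposition.posPart.real U -
      Δ.toJordanDecomposition.negPart.real U := fun U hU => by
    conv_lhs => rw [Δ.eq_posPart_sub_negPart]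
    rw [_root_.sub_apply, Measure.toSignedMeasure_apply_measurable hU,
      Measure.toSignedMeasure_apply_measurable hU]
  have hST := hS.prod hT
  simp only [_root_.sub_apply, _root_.add_apply,
    Measure.toSignedMeasure_apply_measurable hST, measureReal_prod_prod,
    ContinuousLinearMap.mul_apply', h S hS, h T hT]
  ring

theorem integral_prod_mul_eq {f : ℝ × ℝ → ℝ}
    (h : ∀ a ∈ ({Δ.toJordanDecomposition.posPart, Δ.toJordanDecomposition.negPart} :
      Set (Measure ℝ)), ∀ b ∈ ({Δ.toJordanDecomposition.posPart,
        Δ.toJordanDecomposition.negPart} : Set (Measure ℝ)), Integrable f (a.prod b)) :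
    ∫ᵛ u, f u ∂<•(Δ.prod Δ (ContinuousLinearMap.mul ℝ ℝ)) =
      (∫ u, f u ∂(Δ.toJordanDecomposition.posPart.prod Δ.toJordanDecomposition.posPart) +
        ∫ u, f u ∂(Δ.toJordanDecomposition.negPart.prod Δ.toJordanDecomposition.negPart)) -
      (∫ u, f u ∂(Δ.toJordanDecomposition.posPart.prod Δ.toJordanDecomposition.negPart) +
        ∫ u, f u ∂(Δ.toJordanDecomposition.negPart.prod Δ.toJordanDecomposition.posPart)) := by
  have hi : ∀ (a b : Measure ℝ) [IsFiniteMeasure a] [IsFiniteMeasure b],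
      Integrable f (a.prod b) → VectorMeasure.Integrable (a.prod b).toSignedMeasure f :=
    fun a b _ _ hab => by simpa [VectorMeasure.Integrable] using hab
  have h11 := hi _ _ (h _ (.inl rfl) _ (.inl rfl))
  have h12 := hi _ _ (h _ (.inl rfl) _ (.inr rfl))
  have h21 := hi _ _ (h _ (.inr rfl) _ (.inl rfl))
  have h22 := hi _ _ (h _ (.inr rfl) _ (.inr rfl))
  rw [prod_mul_eq, VectorMeasure.integral_sub_vectorMeasure (h11.add_vectorMeasure h22)
    (h12.add_vectorMeasure h21), VectorMeasure.integral_add_vectorMeasure h11 h22,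
    VectorMeasure.integral_add_vectorMeasure h12 h21]
  simp only [VectorMeasure.integral_toSignedMeasure]

end MeasureTheory.SignedMeasure

/-- Fubini for an average over translates. -/
theorem PolyBounded.integral_integral_add_swap {f : ℝ → ℝ} (hf : PolyBounded f)
    {μ B : Measure ℝ} (hμ : PolyMoments μ) (hB : PolyMoments B) :
    ∫ x, ∫ v, f (x + v) ∂B ∂μ = ∫ v, ∫ x, f (v + x) ∂μ ∂B := by
  have := hμ.isFiniteMeasure
  have := hB.isFiniteMeasure
  rw [integral_integral_swap (hf.integrable_prod_add hμ hB)]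
  simp_rw [add_comm]

/-! ### Derivatives of powers of `|x|`, `x₊` and `x₋`. -/

theorem hasDerivAt_posPart_rpow {p : ℝ} (hp : 1 < p) (x : ℝ) :
    HasDerivAt (fun x : ℝ => max 0 x ^ p) (p * max 0 x ^ (p - 1)) x := by
  rcases lt_trichotomy x 0 with hx | rfl | hx
  · rw [max_eq_left hx.le, Real.zero_rpow (by linarith), mul_zero]
    refine (hasDerivAt_const x (0 : ℝ)).congr_of_eventuallyEq ?_
    filter_upwards [Iio_mem_nhds hx] with y hy
    rw [max_eq_left (le_of_lt hy), Real.zero_rpow (by linarith)]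
  · rw [max_self, Real.zero_rpow (by linarith), mul_zero]
    -- At the origin `y₊^p ≤ |y|^p`, and the right side is `o(y)`.
    have h := hasDerivAt_abs_rpow 0 hp
    rw [mul_zero, hasDerivAt_iff_isLittleO_nhds_zero] at h
    rw [hasDerivAt_iff_isLittleO_nhds_zero]
    refine Asymptotics.IsBigO.trans_isLittleO (Asymptotics.IsBigO.of_bound 1
      (Eventually.of_forall fun y => ?_)) h
    have hp0 : p ≠ 0 := by linarith
    simp only [zero_add, max_self, abs_zero, Real.zero_rpow hp0, sub_zero, smul_zero, one_mul]
    rw [Real.norm_of_nonneg (by positivity), Real.norm_of_nonneg (by positivity)]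
    exact Real.rpow_le_rpow (le_max_left _ _) (max_le (abs_nonneg y) (le_abs_self y))
      (by linarith)
  · rw [max_eq_right hx.le]
    refine (Real.hasDerivAt_rpow_const (Or.inl hx.ne')).congr_of_eventuallyEq ?_
    filter_upwards [Ioi_mem_nhds hx] with y hy
    rw [max_eq_right (le_of_lt hy)]

theorem hasDerivAt_negPart_rpow {p : ℝ} (hp : 1 < p) (x : ℝ) :
    HasDerivAt (fun x : ℝ => max 0 (-x) ^ p) (-(p * max 0 (-x) ^ (p - 1))) x := by
  have := (hasDerivAt_posPart_rpow hp (-x)).comp x (hasDerivAt_neg x)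
  rw [mul_neg_one] at this
  exact this

theorem abs_rpow_eq_add {p : ℝ} (hp : p ≠ 0) (x : ℝ) :
    |x| ^ p = max 0 x ^ p + max 0 (-x) ^ p := by
  rcases le_total 0 x with h | h
  · rw [abs_of_nonneg h, max_eq_right h, max_eq_left (by linarith), Real.zero_rpow hp, add_zero]
  · rw [abs_of_nonpos h, max_eq_left h, max_eq_right (by linarith), Real.zero_rpow hp, zero_add]

theorem absPosNeg_basic {φ : ℝ → ℝ} (hφ : φ ∈ absPosNeg) :
    Continuous φ ∧ (∀ x, 0 ≤ φ x) ∧ ∀ x, φ x ≤ |x| := by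
  rcases hφ with rfl | rfl | rfl
  · exact ⟨continuous_abs, abs_nonneg, fun _ => le_rfl⟩
  · exact ⟨by fun_prop, fun x => le_max_left _ _, fun x => max_le (abs_nonneg x) (le_abs_self x)⟩
  · exact ⟨by fun_prop, fun x => le_max_left _ _, fun x => max_le (abs_nonneg x) (neg_le_abs x)⟩

theorem polyBounded_absPosNeg_rpow {φ : ℝ → ℝ} (hφ : φ ∈ absPosNeg) {p : ℝ} (hp : 0 ≤ p) :
    PolyBounded fun x => φ x ^ p :=
  polyBounded_rpow (absPosNeg_basic hφ).1 (absPosNeg_basic hφ).2.1 (absPosNeg_basic hφ).2.2 hp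

/-- The power functions are twice continuously differentiable. -/
theorem exists_hasDerivAt_rpow {φ : ℝ → ℝ} (hφ : φ ∈ absPosNeg) {p : ℝ} (hp : 2 < p) :
    ∃ χ : ℝ → ℝ, PolyBounded χ ∧ (∀ x, HasDerivAt (fun x => φ x ^ p) (χ x) x) ∧
      ∀ x, HasDerivAt χ (p * (p - 1) * φ x ^ (p - 2)) x := by
  have hpos : ∀ x : ℝ, HasDerivAt (fun x : ℝ => p * max 0 x ^ (p - 1))
      (p * (p - 1) * max 0 x ^ (p - 2)) x := fun x => by
    have := (hasDerivAt_posPart_rpow (p := p - 1) (by linarith) x).const_mul p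
    rw [← mul_assoc, show p - 1 - 1 = p - 2 by ring] at this
    exact this
  have hneg : ∀ x : ℝ, HasDerivAt (fun x : ℝ => -(p * max 0 (-x) ^ (p - 1)))
      (p * (p - 1) * max 0 (-x) ^ (p - 2)) x := fun x => by
    have := ((hasDerivAt_negPart_rpow (p := p - 1) (by linarith) x).const_mul p).neg
    rw [mul_neg, neg_neg, ← mul_assoc, show p - 1 - 1 = p - 2 by ring] at this
    exact this
  have bpos : PolyBounded fun x : ℝ => p * max 0 x ^ (p - 1) :=
    (polyBounded_absPosNeg_rpow (φ := fun x => max 0 x) (by simp [absPosNeg])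
      (by linarith)).const_mul p
  have bneg : PolyBounded fun x : ℝ => -(p * max 0 (-x) ^ (p - 1)) := by
    simpa only [neg_mul] using (polyBounded_absPosNeg_rpow (φ := fun x => max 0 (-x))
      (by simp [absPosNeg]) (p := p - 1) (by linarith)).const_mul (-p)
  rcases hφ with rfl | rfl | rfl
  · refine ⟨_, bpos.add bneg, fun x => ?_, fun x => ?_⟩
    · simp_rw [abs_rpow_eq_add (by linarith : p ≠ 0)]
      exact (hasDerivAt_posPart_rpow (by linarith) x).add
        (hasDerivAt_negPart_rpow (by linarith) x)
    · rw [abs_rpow_eq_add (by linarith : p - 2 ≠ 0), mul_add]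
      exact (hpos x).add (hneg x)
  · exact ⟨_, bpos, fun x => hasDerivAt_posPart_rpow (by linarith) x, hpos⟩
  · exact ⟨_, bneg, fun x => hasDerivAt_negPart_rpow (by linarith) x, hneg⟩

/-! ### The characteristic function of `Y_{H_t}`, and absolute convergence. -/

/-- The exponent is linear in the measure, so `H + τΔ` splits into `H` and the two Jordan parts of
`Δ`. This puts `Y_{H_τ}` on the affine path above. -/
theorem charFun_of_isYVariable {Ω : Type*} [MeasurableSpace Ω] {P : Measure Ω}
    {H : Measure ℝ} [IsFiniteMeasure H] {Δ : SignedMeasure ℝ} {τ : ℝ} {Z : Ω → ℝ}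
    (h : IsYVariable P Z (perturbedMeasure H Δ τ)) (k : ℝ) :
    charFun (P.map Z) k = Complex.exp (pathExponent (taylorMix H)
      (taylorMix Δ.toJordanDecomposition.posPart)
      (taylorMix Δ.toJordanDecomposition.negPart) τ k) := by
  have hi := fun (μ : Measure ℝ) (_ : IsFiniteMeasure μ) => integrable_taylorRemainder μ k
  have hv : VectorMeasure.Integrable Δ (fun u : ℝ =>
      taylorRemainder 1 Complex.exp 0 (Complex.I * (k : ℂ) * ((u : ℝ) : ℂ))) := by
    rw [VectorMeasure.Integrable, ← SignedMeasure.totalVariation_eq_variation,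
      SignedMeasure.totalVariation]
    exact (hi _ inferInstance).add_measure (hi _ inferInstance)
  rw [h.charFun_eq k, pathExponent, perturbedMeasure, charFun_taylorMix, charFun_taylorMix,
    charFun_taylorMix, VectorMeasure.integral_add_vectorMeasure _ (hv.smul_vectorMeasure τ),
    VectorMeasure.integral_smul_vectorMeasure, VectorMeasure.integral_toSignedMeasure,
    SignedMeasure.integral_eq_sub (hi _ inferInstance) (hi _ inferInstance), Complex.real_smul]
  simpa [VectorMeasure.Integrable] using hi H inferInstance

section Integrability

variable {Ω : Type*} [MeasurableSpace Ω] {P : Measure Ω} {X : Ω → ℝ}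

theorem PolyBounded.integrable_average_joint {f : ℝ → ℝ} (hf : PolyBounded f)
    {V : Measure ℝ} (hV : PolyMoments V) (hX : Measurable X) (hXm : PolyMoments (P.map X)) :
    Integrable (fun x : (ℝ × ℝ) × Ω => (1 - x.1.2) * f (x.1.2 * x.1.1 + X x.2))
      ((V.prod (volume.restrict (Ioc 0 1))).prod P) := by
  have := hV.isFiniteMeasure
  obtain ⟨C, m, hC, h⟩ := hf.exists_bound_add
  have hXi : Integrable (fun ω => (1 + X ω ^ 2) ^ m) P :=
    (integrable_map_measure (by fun_prop) hX.aemeasurable).1 (hXm m)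
  refine ((((hV m).mul_prod (integrable_const (1 : ℝ) (μ := volume.restrict (Ioc (0 : ℝ) 1)))).mul_prod
    hXi).const_mul C).mono' ?_ ?_
  · have := hf.continuous.measurable
    exact Measurable.aestronglyMeasurable (by fun_prop)
  · have hs : ∀ᵐ x ∂((V.prod (volume.restrict (Ioc (0 : ℝ) 1))).prod P), x.1.2 ∈ Ioc (0 : ℝ) 1 :=
      Measure.quasiMeasurePreserving_fst.ae (p := fun y : ℝ × ℝ => y.2 ∈ Ioc (0 : ℝ) 1)
        (Measure.quasiMeasurePreserving_snd.ae (ae_restrict_mem measurableSet_Ioc))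
    filter_upwards [hs] with x hx
    rw [norm_mul, Real.norm_of_nonneg (by linarith [hx.2] : 0 ≤ 1 - x.1.2), mul_one]
    have h1 := weight_mul_le m (abs_le.2 ⟨by linarith [hx.1], hx.2⟩ : |x.1.2| ≤ 1) x.1.1
    calc (1 - x.1.2) * ‖f (x.1.2 * x.1.1 + X x.2)‖ ≤ 1 * ‖f (x.1.2 * x.1.1 + X x.2)‖ :=
          mul_le_mul_of_nonneg_right (by linarith [hx.1]) (norm_nonneg _)
      _ = |f (x.1.2 * x.1.1 + X x.2)| := one_mul _
      _ ≤ C * ((1 + (x.1.2 * x.1.1) ^ 2) ^ m * (1 + X x.2 ^ 2) ^ m) := h _ _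
      _ ≤ _ := by gcongr

theorem PolyBounded.integrable_double_average_joint {f : ℝ → ℝ} (hf : PolyBounded f)
    {V : Measure ℝ} (hV : PolyMoments V) (hX : Measurable X) (hXm : PolyMoments (P.map X)) :
    Integrable (fun x : ((ℝ × ℝ) × (ℝ × ℝ)) × Ω => (1 - x.1.2.1) * (1 - x.1.2.2) *
        f (x.1.2.1 * x.1.1.1 + x.1.2.2 * x.1.1.2 + X x.2))
      (((V.prod V).prod (volume.restrict (Ioo (0 : ℝ) 1 ×ˢ Ioo (0 : ℝ) 1))).prod P) := by
  have := hV.isFiniteMeasure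
  have : IsFiniteMeasure ((volume : Measure (ℝ × ℝ)).restrict
      (Ioo (0 : ℝ) 1 ×ˢ Ioo (0 : ℝ) 1)) := ⟨by
    rw [Measure.restrict_apply_univ, Measure.volume_eq_prod, Measure.prod_prod]
    simp⟩
  obtain ⟨C, m, hC, h⟩ := hf.exists_bound_add
  have hXi : Integrable (fun ω => (1 + X ω ^ 2) ^ m) P :=
    (integrable_map_measure (by fun_prop) hX.aemeasurable).1 (hXm m)
  refine (((((hV m).mul_prod (hV m)).mul_prod (integrable_const (1 : ℝ)
    (μ := (volume : Measure (ℝ × ℝ)).restrict (Ioo (0 : ℝ) 1 ×ˢ Ioo (0 : ℝ) 1)))).mul_prod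
    hXi).const_mul (C * 2 ^ m)).mono' ?_ ?_
  · have := hf.continuous.measurable
    exact Measurable.aestronglyMeasurable (by fun_prop)
  · have hs : ∀ᵐ x ∂(((V.prod V).prod
        (volume.restrict (Ioo (0 : ℝ) 1 ×ˢ Ioo (0 : ℝ) 1))).prod P),
        x.1.2 ∈ Ioo (0 : ℝ) 1 ×ˢ Ioo (0 : ℝ) 1 :=
      Measure.quasiMeasurePreserving_fst.ae
        (p := fun y : (ℝ × ℝ) × (ℝ × ℝ) => y.2 ∈ Ioo (0 : ℝ) 1 ×ˢ Ioo (0 : ℝ) 1)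
        (Measure.quasiMeasurePreserving_snd.ae
          (ae_restrict_mem (measurableSet_Ioo.prod measurableSet_Ioo)))
    filter_upwards [hs] with x hx
    obtain ⟨hx1, hx2⟩ := hx
    have e1 : 0 ≤ 1 - x.1.2.1 := by linarith [hx1.2]
    have e2 : 0 ≤ 1 - x.1.2.2 := by linarith [hx2.2]
    have e3 : (1 - x.1.2.1) * (1 - x.1.2.2) ≤ 1 :=
      mul_le_one₀ (by linarith [hx1.1]) e2 (by linarith [hx2.1])
    rw [norm_mul, Real.norm_of_nonneg (mul_nonneg e1 e2), mul_one]
    have h1 := weight_mul_le m (abs_le.2 ⟨by linarith [hx1.1], hx1.2.le⟩ : |x.1.2.1| ≤ 1) x.1.1.1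
    have h2 := weight_mul_le m (abs_le.2 ⟨by linarith [hx2.1], hx2.2.le⟩ : |x.1.2.2| ≤ 1) x.1.1.2
    have h3 := weight_add_le m (x.1.2.1 * x.1.1.1) (x.1.2.2 * x.1.1.2)
    calc (1 - x.1.2.1) * (1 - x.1.2.2) *
          ‖f (x.1.2.1 * x.1.1.1 + x.1.2.2 * x.1.1.2 + X x.2)‖
        ≤ 1 * ‖f (x.1.2.1 * x.1.1.1 + x.1.2.2 * x.1.1.2 + X x.2)‖ :=
          mul_le_mul_of_nonneg_right e3 (norm_nonneg _)
      _ = |f (x.1.2.1 * x.1.1.1 + x.1.2.2 * x.1.1.2 + X x.2)| := one_mul _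
      _ ≤ C * ((1 + (x.1.2.1 * x.1.1.1 + x.1.2.2 * x.1.1.2) ^ 2) ^ m * (1 + X x.2 ^ 2) ^ m) :=
          h _ _
      _ ≤ C * ((2 ^ m * ((1 + x.1.1.1 ^ 2) ^ m * (1 + x.1.1.2 ^ 2) ^ m)) *
          (1 + X x.2 ^ 2) ^ m) := by
          gcongr
          exact h3.trans (by gcongr)
      _ = _ := by ring

theorem integral_map_add {f : ℝ → ℝ} (hf : Continuous f) (hX : Measurable X) (v : ℝ) :
    ∫ ω, f (v + X ω) ∂P = ∫ x, f (v + x) ∂(P.map X) :=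
  (integral_map hX.aemeasurable (hf.comp (by fun_prop)).aestronglyMeasurable).symm

end Integrability

/-! ### Signed averages and the right-hand sides of the two identities. -/

section SignedIntegrals

variable {Δ : SignedMeasure ℝ} {μ : Measure ℝ}

/-- The average of the translates of `f` with respect to the signed measure obtained from `Δ` by
the triangular mixture. -/
noncomputable def signedAverage (Δ : SignedMeasure ℝ) (f : ℝ → ℝ) (x : ℝ) : ℝ :=
  ∫ v, f (x + v) ∂(taylorMix Δ.toJordanDecomposition.posPart) -
    ∫ v, f (x + v) ∂(taylorMix Δ.toJordanDecomposition.negPart)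

theorem PolyBounded.signedAverage {f : ℝ → ℝ} (hf : PolyBounded f)
    (hp : PolyMoments Δ.toJordanDecomposition.posPart)
    (hn : PolyMoments Δ.toJordanDecomposition.negPart) : PolyBounded (signedAverage Δ f) :=
  (hf.integral_add hp.taylorMix).sub (hf.integral_add hn.taylorMix)

theorem hasDerivAt_signedAverage {f f' : ℝ → ℝ} (hf : PolyBounded f) (hf' : PolyBounded f')
    (hd : ∀ x, HasDerivAt f (f' x) x)
    (hp : PolyMoments Δ.toJordanDecomposition.posPart)
    (hn : PolyMoments Δ.toJordanDecomposition.negPart) (x : ℝ) :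
    HasDerivAt (signedAverage Δ f) (signedAverage Δ f' x) x :=
  (hf.hasDerivAt_integral_add hf' hd hp.taylorMix x).sub
    (hf.hasDerivAt_integral_add hf' hd hn.taylorMix x)

theorem signedAverage_const_mul (c : ℝ) (f : ℝ → ℝ) (x : ℝ) :
    signedAverage Δ (fun y => c * f y) x = c * signedAverage Δ f x := by
  simp only [signedAverage, integral_const_mul, mul_sub]

theorem integral_signedAverage {f : ℝ → ℝ} (hf : PolyBounded f) (hμ : PolyMoments μ)
    (hp : PolyMoments Δ.toJordanDecomposition.posPart)
    (hn : PolyMoments Δ.toJordanDecomposition.negPart) :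
    ∫ x, signedAverage Δ f x ∂μ =
      ∫ v, ∫ x, f (v + x) ∂μ ∂(taylorMix Δ.toJordanDecomposition.posPart) -
      ∫ v, ∫ x, f (v + x) ∂μ ∂(taylorMix Δ.toJordanDecomposition.negPart) := by
  unfold signedAverage
  rw [integral_sub ((hf.integral_add hp.taylorMix).integrable hμ)
    ((hf.integral_add hn.taylorMix).integrable hμ),
    hf.integral_integral_add_swap hμ hp.taylorMix, hf.integral_integral_add_swap hμ hn.taylorMix]

/-- Fubini on each Jordan part identifies the integral in the first identity with the value produced
by the forward equation. -/
theorem vectorIntegral_average_eq {f : ℝ → ℝ} (hf : PolyBounded f) (hμ : PolyMoments μ)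
    (hp : PolyMoments Δ.toJordanDecomposition.posPart)
    (hn : PolyMoments Δ.toJordanDecomposition.negPart) :
    ∫ᵛ u, (∫ s in (0 : ℝ)..1, (1 - s) * ∫ x, f (s * u + x) ∂μ) ∂<•Δ =
      ∫ x, signedAverage Δ f x ∂μ := by
  have hK := hf.integral_add hμ
  rw [integral_signedAverage hf hμ hp hn,
    integral_taylorMix (hK.integrable hp.taylorMix),
    integral_taylorMix (hK.integrable hn.taylorMix)]
  exact SignedMeasure.integral_eq_sub
    (integrable_average_of_taylorMix (hK.integrable hp.taylorMix))
    (integrable_average_of_taylorMix (hK.integrable hn.taylorMix))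

theorem integral_integral_signedAverage {f : ℝ → ℝ} (hf : PolyBounded f) (hμ : PolyMoments μ)
    (hp : PolyMoments Δ.toJordanDecomposition.posPart)
    (hn : PolyMoments Δ.toJordanDecomposition.negPart) {B : Measure ℝ} (hB : PolyMoments B) :
    ∫ v, ∫ x, signedAverage Δ f (v + x) ∂μ ∂B =
      ∫ v, ∫ w, ∫ x, f (v + w + x) ∂μ ∂(taylorMix Δ.toJordanDecomposition.posPart) ∂B -
      ∫ v, ∫ w, ∫ x, f (v + w + x) ∂μ ∂(taylorMix Δ.toJordanDecomposition.negPart) ∂B := by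
  have hK := hf.integral_add hμ
  rw [← integral_sub ((hK.integral_add hp.taylorMix).integrable hB)
    ((hK.integral_add hn.taylorMix).integrable hB)]
  refine integral_congr_ae (Eventually.of_forall fun v => ?_)
  have hfv : PolyBounded fun x => f (v + x) := by
    refine ⟨hf.continuous.comp (by fun_prop), ?_⟩
    obtain ⟨C, m, _, h⟩ := hf.exists_bound_add
    exact ⟨C * (1 + v ^ 2) ^ m, m, fun x => by rw [mul_assoc]; exact h v x⟩
  have := integral_signedAverage hfv hμ hp hn
  simp only [signedAverage, ← add_assoc] at this ⊢
  exact this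

/-- The four products of Jordan parts match the four terms of the iterated signed average. -/
theorem vectorIntegral_double_average_eq {f : ℝ → ℝ} (hf : PolyBounded f) (hμ : PolyMoments μ)
    (hp : PolyMoments Δ.toJordanDecomposition.posPart)
    (hn : PolyMoments Δ.toJordanDecomposition.negPart) :
    ∫ᵛ u : ℝ × ℝ, (∫ s in Ioo (0 : ℝ) 1 ×ˢ Ioo (0 : ℝ) 1, (1 - s.1) * (1 - s.2) *
        ∫ x, f (s.1 * u.1 + s.2 * u.2 + x) ∂μ) ∂<•(Δ.prod Δ (ContinuousLinearMap.mul ℝ ℝ)) =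
      ∫ x, signedAverage Δ (signedAverage Δ f) x ∂μ := by
  have hK := hf.integral_add hμ
  rw [SignedMeasure.integral_prod_mul_eq, hK.integral_double_average hp hp,
    hK.integral_double_average hn hn, hK.integral_double_average hp hn,
    hK.integral_double_average hn hp,
    integral_signedAverage (hf.signedAverage hp hn) hμ hp hn,
    integral_integral_signedAverage hf hμ hp hn hp.taylorMix,
    integral_integral_signedAverage hf hμ hp hn hn.taylorMix]
  · ring
  · rintro a (rfl | rfl) b (rfl | rfl)
    exacts [hK.integrable_double_average hp hp, hK.integrable_double_average hp hn,
      hK.integrable_double_average hn hp, hK.integrable_double_average hn hn]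

end SignedIntegrals

/-! ### The forward equation for `Y + Y_{H_t}` and the conclusion. -/

/-- The forward equation along the family of laws of `Y + Y_{H + tΔ}`, for smooth test functions of
polynomial growth. -/
theorem hasDerivWithinAt_integral_of_isYVariable {Ω : Type*} [MeasurableSpace Ω] {P : Measure Ω}
    [IsProbabilityMeasure P] {t₀ : ℝ} {H : Measure ℝ} [IsFiniteMeasure H] {Δ : SignedMeasure ℝ}
    {Y : Ω → ℝ} (hY : Measurable Y) {Z : ℝ → Ω → ℝ}
    (hZ : ∀ t ∈ Ico 0 t₀, IsYVariable P (Z t) (perturbedMeasure H Δ t))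
    (hYZ : ∀ t ∈ Ico 0 t₀, IndepFun Y (Z t) P)
    (hYm : PolyMoments (P.map Y)) (hH : PolyMoments H)
    (hp : PolyMoments Δ.toJordanDecomposition.posPart)
    (hn : PolyMoments Δ.toJordanDecomposition.negPart)
    {g g' g'' : ℝ → ℝ} (hd1 : ∀ x, HasDerivAt g (g' x) x)
    (hd2 : ∀ x, HasDerivAt g' (g'' x) x) (hg : PolyBounded g) (hg'' : PolyBounded g'')
    {t : ℝ} (ht : t ∈ Ico 0 t₀) :
    HasDerivWithinAt (fun r => ∫ ω, g (Y ω + Z r ω) ∂P)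
      (∫ ω, signedAverage Δ g'' (Y ω + Z t ω) ∂P) (Ici t) t := by
  -- The compact interval `[0, b]` lies in `[0, t₀)` and contains a right neighbourhood of `t`, so
  -- clamping to it does not affect the right derivative.
  obtain ⟨b, htb, hbt⟩ := exists_between ht.2
  have hb : 0 ≤ b := ht.1.trans htb.le
  have hsub : ∀ τ ∈ Icc 0 b, τ ∈ Ico 0 t₀ := fun τ hτ => ⟨hτ.1, hτ.2.trans_lt hbt⟩
  have hζ : ∀ τ ∈ Icc 0 b, IsProbabilityMeasure (P.map (Z τ)) := fun τ hτ =>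
    Measure.isProbabilityMeasure_map (hZ τ (hsub τ hτ)).measurable.aemeasurable
  have hηp : IsProbabilityMeasure (P.map Y) := Measure.isProbabilityMeasure_map hY.aemeasurable
  have hc : ∀ τ ∈ Icc 0 b, ∀ k, charFun (P.map (Z τ)) k = _ := fun τ hτ k =>
    charFun_of_isYVariable (hZ τ (hsub τ hτ)) k
  have hpath := isPolyPath_conv (ζ := fun τ => P.map (Z τ)) hb hYm hH.taylorMix hp.taylorMix
    hn.taylorMix hζ hc
  have hint : ∀ {f : ℝ → ℝ}, Continuous f → ∀ τ ∈ Icc 0 b,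
      ∫ x, f x ∂(P.map Y ∗ P.map (Z (clampTime b τ))) = ∫ ω, f (Y ω + Z τ ω) ∂P := by
    intro f hf τ hτ
    have hm := (hZ τ (hsub τ hτ)).measurable
    rw [clampTime_of_mem hτ, ← (hYZ τ (hsub τ hτ)).map_add_eq_map_conv_map₀ hY.aemeasurable
      hm.aemeasurable, integral_map (hY.add hm).aemeasurable hf.aestronglyMeasurable]
    rfl
  have key := hpath.hasDerivWithinAt_integral hp.taylorMix hn.taylorMix htb
    (fun k r hr1 hr2 => charFun_conv_sub (η := P.map Y) (ζ := fun τ => P.map (Z τ)) hζ hc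
      ht.1 hr1 hr2 k) hd1 hd2 hg hg''
  have hval : ∫ x, (∫ v, g'' (x + v) ∂(taylorMix Δ.toJordanDecomposition.posPart) -
      ∫ v, g'' (x + v) ∂(taylorMix Δ.toJordanDecomposition.negPart))
        ∂(P.map Y ∗ P.map (Z (clampTime b t))) =
      ∫ ω, signedAverage Δ g'' (Y ω + Z t ω) ∂P :=
    hint (hg''.signedAverage hp hn).continuous t ⟨ht.1, htb.le⟩
  rw [hval] at key
  refine key.congr_of_eventuallyEq ?_ (hint hg.continuous t ⟨ht.1, htb.le⟩).symm
  filter_upwards [Icc_mem_nhdsGE htb] with r hr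
  exact (hint hg.continuous r ⟨ht.1.trans hr.1, hr.2⟩).symm

theorem lemma4 {Ω : Type*} [MeasurableSpace Ω] (P : Measure Ω) [IsProbabilityMeasure P]
    (q t₀ σ : ℝ) (hq : 2 < q) (ht₀ : 0 < t₀) (hσ : 0 < σ)
    (H : Measure ℝ) [IsFiniteMeasure H] (Δ : SignedMeasure ℝ)
    (hHt : ∀ t ∈ Icc 0 t₀, 0 ≤ perturbedMeasure H Δ t)
    (Y : Ω → ℝ) (hY : Measurable Y)
    (Z : ℝ → Ω → ℝ) (hZ : ∀ t ∈ Ico 0 t₀, IsYVariable P (Z t) (perturbedMeasure H Δ t))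
    (hYZ : ∀ t ∈ Ico 0 t₀, IndepFun Y (Z t) P)
    (hexp : ∫⁻ u, ENNReal.ofReal (Real.exp (σ * |u|)) ∂(P.map Y + H + Δ.totalVariation) < ⊤) :
    ∀ φ ∈ absPosNeg, ∀ t ∈ Ico 0 t₀,
      (Integrable (fun ω => φ (Y ω + Z t ω) ^ q) P ∧
        Integrable (fun x : (ℝ × ℝ) × Ω =>
            (1 - x.1.2) * φ (x.1.2 * x.1.1 + Y x.2 + Z t x.2) ^ (q - 2))
          ((Δ.totalVariation.prod (volume.restrict (Ioc 0 1))).prod P) ∧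
        HasDerivWithinAt (fun r => ∫ ω, φ (Y ω + Z r ω) ^ q ∂P)
          (q * (q - 1) *
            ∫ᵛ u, (∫ s in (0 : ℝ)..1,
              (1 - s) * ∫ ω, φ (s * u + Y ω + Z t ω) ^ (q - 2) ∂P) ∂<•Δ)
          (Ici t) t) ∧
      (4 < q →
        Integrable (fun x : ((ℝ × ℝ) × (ℝ × ℝ)) × Ω =>
            (1 - x.1.2.1) * (1 - x.1.2.2) *
              φ (x.1.2.1 * x.1.1.1 + x.1.2.2 * x.1.1.2 + Y x.2 + Z t x.2) ^ (q - 4))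
          (((Δ.totalVariation.prod Δ.totalVariation).prod
            (volume.restrict (Ioo (0 : ℝ) 1 ×ˢ Ioo (0 : ℝ) 1))).prod P) ∧
        HasDerivWithinAt
          (fun r => derivWithin (fun r' => ∫ ω, φ (Y ω + Z r' ω) ^ q ∂P) (Ici r) r)
          (q * (q - 1) * (q - 2) * (q - 3) *
            ∫ᵛ u : ℝ × ℝ, (∫ s in Ioo (0 : ℝ) 1 ×ˢ Ioo (0 : ℝ) 1,
              (1 - s.1) * (1 - s.2) *
                ∫ ω, φ (s.1 * u.1 + s.2 * u.2 + Y ω + Z t ω) ^ (q - 4) ∂P)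
              ∂<•(Δ.prod Δ (ContinuousLinearMap.mul ℝ ℝ)))
          (Ici t) t) := by

  have hle : ∀ {ν : Measure ℝ}, ν ≤ P.map Y + H + Δ.totalVariation → PolyMoments ν := fun hν =>
    PolyMoments.of_lintegral_exp hσ ((lintegral_mono' hν le_rfl).trans_lt hexp)
  have hYm : PolyMoments (P.map Y) := hle (Measure.le_add_right (Measure.le_add_right le_rfl))
  have hH : PolyMoments H := hle (Measure.le_add_right (Measure.le_add_left le_rfl))
  have hV : PolyMoments Δ.totalVariation := hle (Measure.le_add_left le_rfl)
  have hp : PolyMoments Δ.toJordanDecomposition.posPart := hV.mono (Measure.le_add_right le_rfl)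
  have hn : PolyMoments Δ.toJordanDecomposition.negPart := hV.mono (Measure.le_add_left le_rfl)
  intro φ hφ t ht
  have hZm := (hZ t ht).measurable
  have hX : Measurable fun ω => Y ω + Z t ω := hY.add hZm
  have hXm : PolyMoments (P.map fun ω => Y ω + Z t ω) := by
    have : IsProbabilityMeasure (P.map (Z t)) := Measure.isProbabilityMeasure_map hZm.aemeasurable
    have : IsProbabilityMeasure (P.map Y) := Measure.isProbabilityMeasure_map hY.aemeasurable
    have e := (hYZ t ht).map_add_eq_map_conv_map₀ hY.aemeasurable hZm.aemeasurable
    change P.map (fun ω => Y ω + Z t ω) = _ at e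
    rw [e]
    exact hYm.conv (polyMoments_of_charFun_eq_exp hH.taylorMix hp.taylorMix hn.taylorMix
      (charFun_of_isYVariable (hZ t ht)))
  have hbd : ∀ {p : ℝ}, 0 ≤ p → PolyBounded fun x => φ x ^ p := polyBounded_absPosNeg_rpow hφ
  have h0 := hbd (p := q) (by linarith)
  have h2 := hbd (p := q - 2) (by linarith)
  -- Needed at every `r`, not only at `t`, since the second derivative differentiates this formula
  -- in `r`.
  have hD : ∀ r ∈ Ico 0 t₀, HasDerivWithinAt (fun r => ∫ ω, φ (Y ω + Z r ω) ^ q ∂P)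
      (q * (q - 1) * ∫ ω, signedAverage Δ (fun x => φ x ^ (q - 2)) (Y ω + Z r ω) ∂P)
      (Ici r) r := fun r hr => by
    obtain ⟨χ, -, hd1, hd2⟩ := exists_hasDerivAt_rpow hφ hq
    have := hasDerivWithinAt_integral_of_isYVariable hY hZ hYZ hYm hH hp hn hd1 hd2 h0
      (h2.const_mul (q * (q - 1))) hr
    simpa only [signedAverage_const_mul, integral_const_mul] using this
  refine ⟨⟨?_, ?_, ?_⟩, fun hq4 => ?_⟩
  · exact (integrable_map_measure h0.continuous.aestronglyMeasurable hX.aemeasurable).1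
      (h0.integrable hXm)
  · simpa only [add_assoc] using h2.integrable_average_joint hV hX hXm
  · convert hD t ht using 2
    rw [← integral_map (f := signedAverage Δ fun x => φ x ^ (q - 2)) hX.aemeasurable
      (h2.signedAverage hp hn).continuous.aestronglyMeasurable,
      ← vectorIntegral_average_eq h2 hXm hp hn]
    simp_rw [← integral_map_add h2.continuous hX, add_assoc]
  · have h4 := hbd (p := q - 4) (by linarith)
    refine ⟨by simpa only [add_assoc] using h4.integrable_double_average_joint hV hX hXm, ?_⟩
    -- As `q - 2 > 2`, the function `φ^(q-2)` is itself `C²`. Its signed average is the next test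
    -- function.
    obtain ⟨χ, hχ, hd1, hd2⟩ := exists_hasDerivAt_rpow hφ (p := q - 2) (by linarith)
    rw [show q - 2 - 2 = q - 4 by ring, show q - 2 - 1 = q - 3 by ring] at hd2
    have h4' := h4.const_mul ((q - 2) * (q - 3))
    have key := (hasDerivWithinAt_integral_of_isYVariable hY hZ hYZ hYm hH hp hn
      (hasDerivAt_signedAverage h2 hχ hd1 hp hn) (hasDerivAt_signedAverage hχ h4' hd2 hp hn)
      (h2.signedAverage hp hn) (h4'.signedAverage hp hn) ht).const_mul (q * (q - 1))
    have hval : q * (q - 1) * ∫ ω, signedAverage Δ (signedAverage Δ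
        fun x => (q - 2) * (q - 3) * φ x ^ (q - 4)) (Y ω + Z t ω) ∂P =
        q * (q - 1) * (q - 2) * (q - 3) *
          ∫ᵛ u : ℝ × ℝ, (∫ s in Ioo (0 : ℝ) 1 ×ˢ Ioo (0 : ℝ) 1,
              (1 - s.1) * (1 - s.2) *
                ∫ ω, φ (s.1 * u.1 + s.2 * u.2 + Y ω + Z t ω) ^ (q - 4) ∂P)
              ∂<•(Δ.prod Δ (ContinuousLinearMap.mul ℝ ℝ)) := by
      simp only [funext (signedAverage_const_mul (Δ := Δ) ((q - 2) * (q - 3)) fun x => φ x ^ (q - 4)),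
        signedAverage_const_mul, integral_const_mul]
      rw [← integral_map (f := signedAverage Δ (signedAverage Δ fun x => φ x ^ (q - 4)))
        hX.aemeasurable
        ((h4.signedAverage hp hn).signedAverage hp hn).continuous.aestronglyMeasurable,
        ← vectorIntegral_double_average_eq h4 hXm hp hn]
      simp_rw [← integral_map_add h4.continuous hX, add_assoc]
      ring
    rw [hval] at key
    -- On a right neighbourhood of `t` the inner right derivative equals the formula from `hD`, so
    -- `key` differentiates the required function.
    refine key.congr_of_eventuallyEq ?_ ((hD t ht).derivWithin (uniqueDiffOn_Ici t t self_mem_Ici))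
    filter_upwards [Ico_mem_nhdsGE ht.2] with r hr
    exact (hD r ⟨ht.1.trans hr.1, hr.2⟩).derivWithin (uniqueDiffOn_Ici r r self_mem_Ici)
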